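/- Let $\mathcal{R}$ be a combinatorial species (a functorial assignment, along bijections, of a finite set $\mathcal{R}[U]$ of structures to each finite set $U$) with a weighting $\kappa$, that is, isomorphism-invariant weights $\kappa(R)\in[0,\infty)$. Put $|\mathcal{R}[k]|_\kappa=\sum_{R\in\mathcal{R}[\{1,\dots,k\}]}\kappa(R)$ and $\omega_k=|\mathcal{R}[k]|_\kappa/k!$, and suppose that $\omega_0>0$ and that $\omega_k>0$ for some $k\ge2$. Write $\mathbf{w}=(\omega_k)_{k\ge0}$, let $\mathsf{span}(\mathbf{w})=\gcd\{k:\omega_k>0\}$, let $\phi(t)=\sum_k\omega_kt^k$ with radius of convergence $\rho$, let $\psi(t)=t\phi'(t)/\phi(t)$ on $[0,\rho)$, and let $\nu=\psi(\rho)=\lim_{t\nearrow\rho}\psi(t)$ if $\rho>0$ and $\nu=0$ if $\rho=0$. Let $\tau\in[0,\rho]$ be the unique solution of $\psi(\tau)=1$ if $\nu\ge1$, and $\tau=\rho$ otherwise; let $\pi_k=\tau^k\omega_k/\phi(\tau)$. The sequence $\mathbf{w}$ has type I$\alpha$ if $\nu\ge1$ and the probability distribution $(\pi_k)_k$ has finite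 variance; in that case its mean is $1$. A plane tree with $n$ vertices has weight $\prod_v\omega_{d^+(v)}$, the product being over its vertices $v$ with outdegrees $d^+(v)$. For $n$ such that some plane tree with $n$ vertices has positive weight (this holds for all sufficiently large $n\equiv1\bmod\mathsf{span}(\mathbf{w})$), let $\mathcal{T}_n$ be a random plane tree with $n$ vertices drawn with probability proportional to its weight. Given $\mathcal{T}_n$, choose independently for each vertex $v$ a structure $\beta_n(v)\in\mathcal{R}[d^+(v)]$ with probability $\kappa(\beta_n(v))/|\mathcal{R}[d^+(v)]|_\kappa$. Let $\hat{\mathcal{T}}$ be the modified Galton--Watson tree of $(\pi_k)_k$: the root is special; normal vertices have offspring distributed according to $(\pi_k)_k$, special vertices have $k$ offspring with probability $k\pi_k$ for $k\in\mathbb{N}_0$ and $\infty$ offspring with probability $1-\sum_kk\pi_k$ (which is $0$ for type I$\alpha$), all independently; all children of a normal vertex are normal, the children of a special vertex with finitely many children are normal except for a uniformly chosen one, which is special, and the children of a special vertex with infinitely many children are all normal. Given $\hat{\mathcal{T}}$, choose independently for each vertex $v$ of finite outdegree a structure $\hat\beta(v)\in\mathcal{R}[d^+(v)]$ with probability $\kappa(\hat\beta(v))/|\mathcal{R}[d^+(v)]|_\kappa$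 (and set $\hat\beta(v)=\infty$ if $d^+(v)=\infty$). For a tree $T$ with structures $\beta(v)$ at its vertices, let $(T,\beta)^{[k]}$ denote its trimming at height $k$: the tree of all vertices of height at most $k$ together with the structures $\beta(v)$ of the vertices $v$ of height less than $k$. Let $d_{\mathrm{TV}}$ denote total variation distance. **Theorem.** If $\mathbf{w}$ has type I$\alpha$, then for any sequence of positive integers $k_n=o(n^{1/2})$, $$d_{\mathrm{TV}}\bigl((\mathcal{T}_n,\beta_n)^{[k_n]},(\hat{\mathcal{T}},\hat\beta)^{[k_n]}\bigr)\to0$$ as $n\to\infty$ with $n\equiv1\bmod\mathsf{span}(\mathbf{w})$. -/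

import Mathlib

open scoped ENNReal NNReal Nat
open MeasureTheory ProbabilityTheory Filter Topology

universe v

noncomputable section

namespace EnrichedTrees

/-! ### Probability preliminaries -/

/-- The probability distribution on `α` whose masses are proportional to the weights `f`.
If `f` cannot be normalised (its total is `0` or `∞`), this is a point mass at `default`. -/
def ofWeights {α : Type*} [Inhabited α] (f : α → ℝ≥0∞) : PMF α :=
  open Classical in
  if h : tsum f ≠ 0 ∧ tsum f ≠ ∞ then PMF.normalize f h.1 h.2 else PMF.pure default

/-- The total variation distance of two probability measures. -/
def tvDist {α : Type*} [MeasurableSpace α] (P Q : Measure α) : ℝ :=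
  ⨆ A : {A : Set α // MeasurableSet A}, |P.real A - Q.real A|

/-! ### Weight sequences and their types -/

section WeightSequences

variable (w : ℕ → ℝ≥0)

/-- The greatest common divisor of the support of the weight sequence. -/
def span : ℕ := Nat.setGcd {k | 0 < w k}

/-- The power series `φ(t) = ∑ ω_k t^k`, evaluated at `t ≥ 0`. -/
def phi (t : ℝ≥0∞) : ℝ≥0∞ := ∑' k, (w k : ℝ≥0∞) * t ^ k

/-- The derivative power series `φ'(t) = ∑ k ω_k t^(k-1)`, evaluated at `t ≥ 0`. -/
def phiDeriv (t : ℝ≥0∞) : ℝ≥0∞ := ∑' k : ℕ, (k : ℝ≥0∞) * (w k : ℝ≥0∞) * t ^ (k - 1)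

/-- The radius of convergence of `φ`. -/
def rho : ℝ≥0∞ := (FormalMultilinearSeries.ofScalars ℝ (fun k => (w k : ℝ))).radius

/-- The function `t φ'(t) / φ(t)` (used for `0 ≤ t < ρ`). -/
def psi (t : ℝ≥0∞) : ℝ≥0∞ := t * phiDeriv w t / phi w t

/-- `ν = lim_{t ↗ ρ} ψ(t)` if `ρ > 0`, and `ν = 0` if `ρ = 0`. -/
def nu : ℝ≥0∞ :=
  open Classical in if rho w = 0 then 0 else limUnder (𝓝[<] (rho w)) (psi w)

/-- The function `ψ` on `[0, ρ]`, with the value `ψ(ρ) = ν` at the right end point. -/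
def psiExt (t : ℝ≥0∞) : ℝ≥0∞ :=
  open Classical in if t < rho w then psi w t else nu w

/-- If `ν ≥ 1`, then `τ` is the unique number in `[0, ρ]` with `ψ(τ) = 1` (the set below is a
singleton); otherwise `τ = ρ`. -/
def tau : ℝ≥0∞ :=
  open Classical in
  if 1 ≤ nu w then sInf {t | t ≤ rho w ∧ psiExt w t = 1} else rho w

/-- The probability distribution `π_k = τ^k ω_k / φ(τ)` on `ℕ`. -/
def offspring : PMF ℕ := ofWeights fun k => (w k : ℝ≥0∞) * tau w ^ k

/-- Type Iα: `ν ≥ 1`, and the distribution `(π_k)` has finite variance. -/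
def TypeIAlpha : Prop :=
  1 ≤ nu w ∧ evariance (fun k : ℕ => (k : ℝ)) (offspring w).toMeasure < ∞

end WeightSequences

/-! ### Plane trees -/

/-- Vertices of the Ulam–Harris tree: finite strings of natural numbers.
The children of `v` are `v ++ [0]`, `v ++ [1]`, … -/
abbrev Vertex : Type := List ℕ

/-- Finite plane trees: a root with an ordered list of `d` plane trees attached to it. -/
inductive PlaneTree : Type
  | node (d : ℕ) (children : Fin d → PlaneTree) : PlaneTree

namespace PlaneTree

instance : Inhabited PlaneTree := ⟨node 0 Fin.elim0⟩

instance : MeasurableSpace PlaneTree := ⊤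

/-- The number of vertices. -/
def size : PlaneTree → ℕ
  | node _ c => 1 + ∑ i, (c i).size

/-- The weight `∏_u ω_{d⁺(u)}`, the product ranging over all vertices `u` of the tree. -/
def weight (w : ℕ → ℝ≥0) : PlaneTree → ℝ≥0
  | node d c => w d * ∏ i, (c i).weight w

/-- The family of outdegrees of a plane tree, as a subtree of the Ulam–Harris tree
(`0` at vertices outside of the tree). -/
def outdegree : PlaneTree → Vertex → ℕ∞
  | node d _, [] => d
  | node d c, i :: u => if h : i < d then (c ⟨i, h⟩).outdegree u else 0

end PlaneTree

/-- The vertex set of the plane tree with the given outdegrees. -/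
def vertices (d : Vertex → ℕ∞) : Set Vertex :=
  {x | ∀ (u : Vertex) (i : ℕ), u ++ [i] <+: x → (i : ℕ∞) < d u}

/-- The simply generated tree with `n` vertices: probability proportional to the weight. -/
def simplyGenerated (w : ℕ → ℝ≥0) (n : ℕ) : PMF PlaneTree :=
  open Classical in ofWeights fun T => if T.size = n then (T.weight w : ℝ≥0∞) else 0

/-- The law of the simply generated tree with `n` vertices, encoded by its outdegrees. -/
def simplyGeneratedLaw (w : ℕ → ℝ≥0) (n : ℕ) : Measure (Vertex → ℕ∞) :=
  (simplyGenerated w n).toMeasure.map PlaneTree.outdegree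

/-! ### The modified Galton–Watson tree -/

/-- The law of `ξ̂`: `P(ξ̂ = k) = k π_k` for finite `k`, and `P(ξ̂ = ∞) = 1 - ∑ k π_k`. -/
def sizeBiased (w : ℕ → ℝ≥0) : PMF ℕ∞ :=
  open Classical in ofWeights fun k =>
    if k = ⊤ then 1 - ∑' j : ℕ, (j : ℝ≥0∞) * offspring w j
    else (k : ℝ≥0∞) * offspring w k.toNat

/-- The joint law of the outdegree `ξ̂` of a special vertex and, if `ξ̂` is finite, of the position
in `{0, …, ξ̂ - 1}` (chosen uniformly) of its special child. -/
def specialOffspring (w : ℕ → ℝ≥0) : PMF (ℕ∞ × ℕ) :=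
  open Classical in (sizeBiased w).bind fun k =>
    (ofWeights fun j : ℕ => if (j : ℕ∞) < k then 1 else 0).map (Prod.mk k)

/-- The random input of the construction: to each vertex of the Ulam–Harris tree we attach,
independently, an outdegree to be used if the vertex is normal, and a pair (outdegree, position of
the special child) to be used if it is special. -/
def branchingInput (w : ℕ → ℝ≥0) : Measure (Vertex → ℕ × (ℕ∞ × ℕ)) :=
  Measure.infinitePi fun _ => (offspring w).toMeasure.prod (specialOffspring w).toMeasure

/-- The special vertices: on the way from the root we always pass to the special child. -/
def IsSpecial (s : Vertex → ℕ × (ℕ∞ × ℕ)) (x : Vertex) : Prop :=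
  ∀ (u : Vertex) (i : ℕ), u ++ [i] <+: x → (s u).2.1 ≠ ⊤ ∧ i = (s u).2.2

/-- The number of offspring that `x` receives if it belongs to the tree. -/
def reproduction (s : Vertex → ℕ × (ℕ∞ × ℕ)) (x : Vertex) : ℕ∞ :=
  open Classical in if IsSpecial s x then (s x).2.1 else ((s x).1 : ℕ∞)

/-- The outdegrees of the modified Galton–Watson tree as a function of the random input
(`0` at vertices outside of the tree). -/
def modifiedGW (s : Vertex → ℕ × (ℕ∞ × ℕ)) (x : Vertex) : ℕ∞ :=
  open Classical in if x ∈ vertices (reproduction s) then reproduction s x else 0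

/-- The law of the modified Galton–Watson tree, encoded by its outdegrees. -/
def modifiedGWLaw (w : ℕ → ℝ≥0) : Measure (Vertex → ℕ∞) :=
  (branchingInput w).map modifiedGW

/-! ### Weighted combinatorial species -/

/-- Combinatorial species: finite sets of structures over finite sets of labels, with functorial
transport along bijections. -/
structure Species where
  obj : (U : Type) → [Finite U] → Type v
  finite_obj : ∀ (U : Type) [Finite U], Finite (obj U)
  transport : ∀ {U V : Type} [Finite U] [Finite V], (U ≃ V) → obj U → obj V
  transport_refl : ∀ (U : Type) [Finite U] (r : obj U), transport (Equiv.refl U) r = r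
  transport_trans : ∀ {U V W : Type} [Finite U] [Finite V] [Finite W] (σ : U ≃ V) (σ' : V ≃ W)
    (r : obj U), transport (σ.trans σ') r = transport σ' (transport σ r)

/-- A weighting of a species: nonnegative weights, invariant under transport. -/
structure Weighting (R : Species.{v}) where
  toFun : ∀ {U : Type} [Finite U], R.obj U → ℝ≥0
  transport_eq : ∀ {U V : Type} [Finite U] [Finite V] (σ : U ≃ V) (r : R.obj U),
    toFun (R.transport σ r) = toFun r

variable {R : Species.{v}} (κ : Weighting R)

/-- The inventory `|R[n]|_κ`. -/
def Weighting.inventory (n : ℕ) : ℝ≥0 := ∑ᶠ r : R.obj (Fin n), κ.toFun r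

/-- The weight sequence `ω_n = |R[n]|_κ / n!`. -/
def Weighting.weightSeq (n : ℕ) : ℝ≥0 := κ.inventory n / (n ! : ℝ≥0)

/-! ### Enriched plane trees -/

/-- The space `X = {*, ∞} ⊔ ⨆ₙ R[n]`. -/
inductive Mark (R : Species.{v}) : Type v
  | star : Mark R
  | infinity : Mark R
  | str (n : ℕ) (r : R.obj (Fin n)) : Mark R

instance : Inhabited (Mark R) := ⟨Mark.star⟩

instance : MeasurableSpace (Mark R) := ⊤

/-- Weights of marks, for choosing a structure from `R[d]`. -/
def Weighting.markWeight (d : ℕ) : Mark R → ℝ≥0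
  | Mark.str n r => if n = d then κ.toFun r else 0
  | _ => 0

/-- A random structure from `R[d]`, with probability proportional to its weight. -/
def Weighting.randomStructure (d : ℕ) : PMF (Mark R) :=
  ofWeights fun x => (κ.markWeight d x : ℝ≥0∞)

/-- Independent random structures, one from `R[d]` for each vertex and each possible
outdegree `d`. -/
def Weighting.structureField : Measure (Vertex × ℕ → Mark R) :=
  Measure.infinitePi fun p => (κ.randomStructure p.2).toMeasure

/-- Decorate the tree with outdegrees `d`: each vertex of finite outdegree `m` receives the
structure from `R[m]` that the family `B` has for it, vertices of infinite outdegree receive `∞`,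
and the placeholder `*` is put at all vertices outside of the tree. -/
def decorate (p : (Vertex → ℕ∞) × (Vertex × ℕ → Mark R)) (x : Vertex) : Mark R :=
  open Classical in
  if x ∉ vertices p.1 then Mark.star
  else if p.1 x = ⊤ then Mark.infinity
  else p.2 (x, (p.1 x).toNat)

/-- The law of the enriched tree obtained from a random tree with law `P` by choosing, conditionally
on the tree, independently for each vertex `x` of finite outdegree a structure from `R[d⁺(x)]` with
probability proportional to its weight. -/
def Weighting.enrich (P : Measure (Vertex → ℕ∞)) : Measure (Vertex → Mark R) :=
  (P.prod κ.structureField).map decorate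

/-- The law of the random enriched plane tree `(𝒯_n, β_n)`. -/
def Weighting.finiteTreeLaw (n : ℕ) : Measure (Vertex → Mark R) :=
  κ.enrich (simplyGeneratedLaw κ.weightSeq n)

/-- The law of the limit enriched tree `(𝒯̂, β̂)`. -/
def Weighting.limitTreeLaw : Measure (Vertex → Mark R) :=
  κ.enrich (modifiedGWLaw κ.weightSeq)

/-- The trimming at height `k`: the vertices of the tree with height at most `k`, together with the
structures of the vertices of height less than `k`. -/
def trim (k : ℕ) (b : Vertex → Mark R) : Set Vertex × (Vertex → Mark R) :=
  ({x | b x ≠ Mark.star ∧ x.length ≤ k}, fun x => if x.length < k then b x else Mark.star)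

/-! ### Measurability of the maps used above -/

theorem measurable_outdegree : Measurable PlaneTree.outdegree := fun _ _ => trivial

theorem measurableSet_mem_vertices (x : Vertex) :
    MeasurableSet {d : Vertex → ℕ∞ | x ∈ vertices d} := by
  have h (u : Vertex) (i : ℕ) : Measurable fun d : Vertex → ℕ∞ => (i : ℕ∞) < d u :=
    (measurable_of_countable fun m : ℕ∞ => (i : ℕ∞) < m).comp (measurable_pi_apply u)
  exact measurableSet_setOfPred.2 (Measurable.forall fun u => Measurable.forall fun i =>
    Measurable.forall fun _ => h u i)

theorem measurable_reproduction : Measurable reproduction := by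
  classical
  refine measurable_pi_iff.2 fun x => ?_
  have h (u : Vertex) (i : ℕ) : Measurable fun s : Vertex → ℕ × (ℕ∞ × ℕ) =>
      (s u).2.1 ≠ ⊤ ∧ i = (s u).2.2 :=
    (measurable_of_countable fun m : ℕ × (ℕ∞ × ℕ) => m.2.1 ≠ ⊤ ∧ i = m.2.2).comp
      (measurable_pi_apply u)
  refine Measurable.ite (measurableSet_setOfPred.2 (Measurable.forall fun u =>
    Measurable.forall fun i => Measurable.forall fun _ => h u i)) (by fun_prop) ?_
  exact (measurable_of_countable (fun m : ℕ × (ℕ∞ × ℕ) => (m.1 : ℕ∞))).comp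
    (measurable_pi_apply x)

theorem measurable_modifiedGW : Measurable modifiedGW := by
  classical
  refine measurable_pi_iff.2 fun x => ?_
  refine Measurable.ite (measurable_reproduction (measurableSet_mem_vertices x)) ?_
    measurable_const
  exact (measurable_pi_apply x).comp measurable_reproduction

theorem measurable_decorate :
    Measurable (decorate : (Vertex → ℕ∞) × (Vertex × ℕ → Mark R) → Vertex → Mark R) := by
  classical
  refine measurable_pi_iff.2 fun x => ?_
  refine Measurable.ite (measurable_fst (measurableSet_mem_vertices x).compl) measurable_const ?_
  refine Measurable.ite ?_ measurable_const ?_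
  · exact ((measurable_pi_apply x).comp measurable_fst) (measurableSet_singleton _)
  · have h : Measurable fun q : ℕ∞ × (Vertex × ℕ → Mark R) => q.2 (x, q.1.toNat) :=
      measurable_from_prod_countable_right fun m => measurable_pi_apply (x, m.toNat)
    have h' : Measurable fun p : (Vertex → ℕ∞) × (Vertex × ℕ → Mark R) => (p.1 x, p.2) :=
      (by fun_prop : Measurable fun p : (Vertex → ℕ∞) × (Vertex × ℕ → Mark R) => p.1 x).prodMk
        measurable_snd
    exact h.comp h'

theorem measurable_trim (k : ℕ) :
    Measurable (trim k : (Vertex → Mark R) → Set Vertex × (Vertex → Mark R)) := by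
  refine Measurable.prodMk ?_ (measurable_pi_iff.2 fun x => ?_)
  · refine measurable_set_iff.2 fun x => ?_
    exact (show Measurable fun m : Mark R => m ≠ Mark.star ∧ x.length ≤ k from
      fun _ _ => trivial).comp (measurable_pi_apply x)
  · by_cases h : x.length < k
    · simpa [h] using measurable_pi_apply x
    · simp [h]

end EnrichedTrees

end

/-!
The theorem compares two random trees whose structures are attached by the same independent field,
so it suffices to compare the families of outdegrees. Structures of vertices of height `k` enter the
trimming at height `k` only through its vertex set, and the trimming is a function of the structure
field and of the outdegrees at heights at most `k` (`trim_decorate_congr`).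

Let `p` be the tilted offspring law `π`. For weights of type Iα it has mean `1` and finite variance
(`tau_spec`, `tsum_mul_offspring`), and the simply generated tree is a Galton-Watson tree with
offspring law `p` conditioned to have `n` vertices (`mass_mul_pow`). For a tree `t` of height at
most `k`, let `L` be its number of vertices of height `k`, let `N` be its number of vertices of
smaller height, and let `q` be the product of the `p`-masses of the outdegrees of the latter.

* The conditioned tree has truncation `t` with probability `q * Z(L, n - N) / Z(1, n)`, where
  `Z(l, m)` is the mass of the forests of `l` trees with `m` vertices in total
  (`tsum_truncate_eq`). By the Otter-Dwass formula `m Z(l, m) = l P(S_m = m - l)`, where `S_m` is a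
  sum of `m` independent steps with law `p` (`mul_coeff_treeSeries_pow`); it follows by induction on
  `m` from exploring the root of the first tree.
* The modified Galton-Watson tree has truncation `t` with probability `q * L`, one summand `q` for
  each position of the spine at height `k` (`lintegral_modifiedGW`).

So the ratio of the two probabilities is `(n / m) * P(S_m = m - L) / P(S_n = n - 1)` with
`m = n - N`. By the local limit theorem (`exists_tendsto_sqrt_mul_stepMass`) it is at least
`1 - o(1)` whenever `L = o(√n)` and `N = o(n)`; here `N ≤ n / 2` is enough, because `n / m ≥ 1`
and only a lower bound is needed. Under the size-biased law `q * L` the means of `L` and `N` are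
`O(k)` and `O(k ^ 2)`, so for `k = o(√n)` Markov's inequality shows that all other trees have total
mass `o(1)`. A lower bound for the ratio suffices, since a one-sided estimate that is uniform over
all events bounds the total variation distance (`tvDist_le`).

The local limit theorem is derived by Fourier inversion from the central limit theorem for
characteristic functions. The required Gaussian domination on `[-π/d, π/d]`, with `d` the span, is
`exists_norm_stepChar_le`.
-/

noncomputable section

namespace EnrichedTrees

/-! ### Sums of independent steps and their Fourier representation -/

section LocalLimit

variable (p : PMF ℕ)

/-- The probability generating series of `p`. -/
def genSeries : PowerSeries ℝ≥0 := PowerSeries.mk fun k => (p k).toNNReal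

/-- The probability that `m` independent steps with law `p` add up to `j`, encoded as the
`j`-th coefficient of the `m`-th power of the generating series. -/
def stepMass (m j : ℕ) : ℝ≥0 := PowerSeries.coeff j (genSeries p ^ m)

/-- The characteristic function of a centred step, i.e. of `ξ - 1` where `ξ` has law `p`. -/
def stepChar (t : ℝ) : ℂ := charFun (p.toMeasure.map fun k : ℕ => (k : ℝ) - 1) t

theorem stepMass_zero (j : ℕ) : stepMass p 0 j = if j = 0 then 1 else 0 := by
  simp [stepMass, PowerSeries.coeff_one]

theorem stepMass_succ (m j : ℕ) :
    stepMass p (m + 1) j =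
      ∑ x ∈ Finset.HasAntidiagonal.antidiagonal j, stepMass p m x.1 * (p x.2).toNNReal := by
  simp [stepMass, pow_succ, PowerSeries.coeff_mul, genSeries]

theorem dvd_of_stepMass_ne_zero {d : ℕ} (hd : ∀ k, p k ≠ 0 → d ∣ k) {m j : ℕ}
    (h : stepMass p m j ≠ 0) : d ∣ j := by
  induction m generalizing j with
  | zero =>
    rw [stepMass_zero] at h
    have : j = 0 := by by_contra hj; simp [hj] at h
    simp [this]
  | succ m ih =>
    rw [stepMass_succ] at h
    obtain ⟨x, hx, hne⟩ := Finset.exists_ne_zero_of_sum_ne_zero h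
    rw [← Finset.HasAntidiagonal.mem_antidiagonal.1 hx]
    refine dvd_add (ih (left_ne_zero_of_mul hne)) (hd _ fun h0 => ?_)
    simp [h0] at hne

theorem summable_toReal : Summable fun k => (p k).toReal :=
  ENNReal.summable_toReal p.tsum_coe_ne_top

theorem tsum_toReal : ∑' k, (p k).toReal = 1 := by
  rw [← ENNReal.tsum_toReal_eq (fun k => p.apply_ne_top k), p.tsum_coe]; rfl

theorem summable_norm_stepMass_mul_pow_and_tsum {z : ℂ} (hz : ‖z‖ ≤ 1) (m : ℕ) :
    (Summable fun j => ‖(stepMass p m j : ℂ) * z ^ j‖) ∧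
      ∑' j, (stepMass p m j : ℂ) * z ^ j = (∑' k, ((p k).toReal : ℂ) * z ^ k) ^ m := by
  have hp : Summable fun k => ‖((p k).toReal : ℂ) * z ^ k‖ := by
    refine (summable_toReal p).of_nonneg_of_le (fun _ => norm_nonneg _) fun k => ?_
    rw [norm_mul, norm_pow, Complex.norm_real, Real.norm_of_nonneg ENNReal.toReal_nonneg]
    exact mul_le_of_le_one_right ENNReal.toReal_nonneg (pow_le_one₀ (norm_nonneg _) hz)
  induction m with
  | zero =>
    have h : (fun j => (stepMass p 0 j : ℂ) * z ^ j) = fun j => if j = 0 then 1 else 0 := by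
      funext j
      rw [stepMass_zero]
      split_ifs with h <;> simp [h]
    constructor
    · rw [show (fun j => ‖(stepMass p 0 j : ℂ) * z ^ j‖) = fun j => if j = 0 then 1 else 0 by
        funext j; rw [congrFun h j]; split_ifs <;> simp]
      exact (hasSum_ite_eq 0 (1 : ℝ)).summable
    · rw [h, tsum_ite_eq]; simp
  | succ m ih =>
    have key : (fun j => (stepMass p (m + 1) j : ℂ) * z ^ j) = fun j =>
        ∑ x ∈ Finset.HasAntidiagonal.antidiagonal j,
          ((stepMass p m x.1 : ℂ) * z ^ x.1) * (((p x.2).toReal : ℂ) * z ^ x.2) := by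
      funext j
      rw [stepMass_succ]
      push_cast
      rw [Finset.sum_mul]
      refine Finset.sum_congr rfl fun x hx => ?_
      rw [← Finset.HasAntidiagonal.mem_antidiagonal.1 hx, pow_add]
      simp only [ENNReal.toReal]
      ring
    refine ⟨?_, ?_⟩
    · have := summable_norm_sum_mul_antidiagonal_of_summable_norm ih.1 hp
      refine this.congr fun j => ?_
      rw [congrFun key j]
    · rw [key, ← tsum_mul_tsum_eq_tsum_sum_antidiagonal_of_summable_norm ih.1 hp, ih.2, pow_succ]

theorem stepChar_eq_tsum (t : ℝ) :
    stepChar p t = Complex.exp (-(t * Complex.I)) *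
      ∑' k, ((p k).toReal : ℂ) * Complex.exp (t * Complex.I) ^ k := by
  rw [stepChar, charFun_apply_real, integral_map (by fun_prop) (by fun_prop), PMF.integral_eq_tsum]
  · rw [← tsum_mul_left]
    refine tsum_congr fun k => ?_
    rw [← Complex.exp_nat_mul, Complex.real_smul]
    have : Complex.exp (↑t * ↑((k : ℝ) - 1) * Complex.I)
        = Complex.exp (-(t * Complex.I)) * Complex.exp (k * (t * Complex.I)) := by
      rw [← Complex.exp_add]; congr 1; push_cast; ring
    rw [this]; ring
  · refine Integrable.of_bound (C := 1) (by fun_prop) (ae_of_all _ fun k => ?_)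
    rw [← Complex.ofReal_mul, Complex.norm_exp_ofReal_mul_I]

theorem integral_exp_period {d : ℕ} (hd : 0 < d) (l : ℤ) :
    ∫ t in (-(Real.pi / d))..(Real.pi / d), Complex.exp (t * Complex.I) ^ (d * l : ℤ) =
      if l = 0 then ((2 * Real.pi / d : ℝ) : ℂ) else 0 := by
  split_ifs with h
  · simp [h]
    ring
  · have hd' : (d : ℂ) ≠ 0 := by exact_mod_cast hd.ne'
    have hl : (l : ℂ) ≠ 0 := by exact_mod_cast h
    have hc : (d * l * Complex.I : ℂ) ≠ 0 := by
      simp [hd', hl]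
    have : ∀ t : ℝ, Complex.exp (t * Complex.I) ^ (d * l : ℤ) =
        Complex.exp ((d * l * Complex.I) * t) := by
      intro t
      rw [← Complex.exp_int_mul]; congr 1; push_cast; ring
    simp_rw [this]
    rw [integral_exp_mul_complex hc, div_eq_zero_iff]
    left
    rw [sub_eq_zero, Complex.exp_eq_exp_iff_exists_int]
    refine ⟨l, ?_⟩
    push_cast
    field_simp
    ring

/-- Fourier inversion on the fundamental interval of a law carried by the multiples of `d`. -/
theorem stepMass_eq_integral {d : ℕ} (hd0 : 0 < d) (hd : ∀ k, p k ≠ 0 → d ∣ k) (m j : ℕ)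
    (hj : d ∣ j) :
    (stepMass p m j : ℂ) = (d / (2 * Real.pi) : ℝ) *
      ∫ t in (-(Real.pi / d))..(Real.pi / d),
        stepChar p t ^ m * Complex.exp (-(t * ((j : ℝ) - m) * Complex.I)) := by
  have hint : ∀ t : ℝ, HasSum
      (fun i => (stepMass p m i : ℂ) * Complex.exp (t * Complex.I) ^ ((i : ℤ) - j))
      (stepChar p t ^ m * Complex.exp (-(t * ((j : ℝ) - m) * Complex.I))) := by
    intro t
    obtain ⟨h1, h2⟩ := summable_norm_stepMass_mul_pow_and_tsum p
      (z := Complex.exp (t * Complex.I)) (by rw [Complex.norm_exp_ofReal_mul_I]) m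
    have := (h1.of_norm.hasSum).mul_right (Complex.exp (-(t * j * Complex.I)))
    rw [h2] at this
    have e1 : (fun i : ℕ => (stepMass p m i : ℂ) * Complex.exp (t * Complex.I) ^ ((i : ℤ) - j)) =
        fun i : ℕ => (stepMass p m i : ℂ) * Complex.exp (t * Complex.I) ^ i *
          Complex.exp (-(t * j * Complex.I)) := by
      funext i
      rw [mul_assoc]
      congr 1
      rw [← Complex.exp_int_mul, ← Complex.exp_nat_mul, ← Complex.exp_add]
      congr 1; push_cast; ring
    have e2 : stepChar p t ^ m * Complex.exp (-(t * ((j : ℝ) - m) * Complex.I)) =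
        (∑' k, ((p k).toReal : ℂ) * Complex.exp (t * Complex.I) ^ k) ^ m *
          Complex.exp (-(t * j * Complex.I)) := by
      rw [stepChar_eq_tsum, mul_pow, ← Complex.exp_nat_mul, mul_comm (Complex.exp _), mul_assoc,
        ← Complex.exp_add]
      congr 2; push_cast; ring
    rw [e1, e2]
    exact this
  have hsum : HasSum (fun i => ∫ t in (-(Real.pi / d))..(Real.pi / d),
      (stepMass p m i : ℂ) * Complex.exp (t * Complex.I) ^ ((i : ℤ) - j))
      (∫ t in (-(Real.pi / d))..(Real.pi / d),
        stepChar p t ^ m * Complex.exp (-(t * ((j : ℝ) - m) * Complex.I))) := by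
    refine intervalIntegral.hasSum_integral_of_dominated_convergence
      (fun i _ => (stepMass p m i : ℝ)) (fun i => ?_) (fun i => ?_) ?_ ?_ ?_
    · refine Continuous.aestronglyMeasurable ?_
      refine continuous_const.mul (Continuous.zpow₀ (by fun_prop) _ fun t => ?_)
      exact Or.inl (Complex.exp_ne_zero _)
    · refine ae_of_all _ fun t _ => ?_
      rw [norm_mul, norm_zpow, Complex.norm_exp_ofReal_mul_I, one_zpow, mul_one]
      simp
    · refine ae_of_all _ fun t _ => ?_
      have := (summable_norm_stepMass_mul_pow_and_tsum p (z := 1) (by simp) m).1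
      simpa using this
    · exact intervalIntegrable_const
    · exact ae_of_all _ fun t _ => hint t
  have hterm : ∀ i, ∫ t in (-(Real.pi / d))..(Real.pi / d),
      (stepMass p m i : ℂ) * Complex.exp (t * Complex.I) ^ ((i : ℤ) - j) =
      if i = j then (stepMass p m j : ℂ) * (2 * Real.pi / d : ℝ) else 0 := by
    intro i
    rw [intervalIntegral.integral_const_mul]
    by_cases hi : stepMass p m i = 0
    · split_ifs with h
      · subst h; simp [hi]
      · simp [hi]
    · obtain ⟨a, rfl⟩ := dvd_of_stepMass_ne_zero p hd hi
      obtain ⟨b, rfl⟩ := hj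
      have h1 := integral_exp_period hd0 ((a : ℤ) - b)
      have h2 : (((d * a : ℕ) : ℤ) - (d * b : ℕ) : ℤ) = d * ((a : ℤ) - b) := by push_cast; ring
      rw [h2, h1]
      have h3 : ((a : ℤ) - b = 0) ↔ (d * a = d * b) := by
        rw [Nat.mul_right_inj hd0.ne']; omega
      simp only [h3]
      split_ifs with h
      · rw [h]
      · simp
  simp_rw [hterm] at hsum
  rw [hsum.unique (hasSum_ite_eq j ((stepMass p m j : ℂ) * (2 * Real.pi / d : ℝ)))]
  have hd' : (d : ℂ) ≠ 0 := by exact_mod_cast hd0.ne'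
  have hpi : (Real.pi : ℂ) ≠ 0 := by exact_mod_cast Real.pi_ne_zero
  push_cast
  field_simp

/-- The characteristic function of a step is bounded by a Gaussian on the fundamental interval
`[-π/d, π/d]`. The integers `k` such that `|sin (t k / 2)|` is `O(√(1 - |χ(t)|))`, uniformly in `t`,
form an ideal of `ℤ` that contains the support of `p`, and hence its greatest common divisor. -/
theorem exists_norm_stepChar_le (h0 : p 0 ≠ 0) (d : ℕ) (hd : d = Nat.setGcd {k | p k ≠ 0})
    (hd0 : 0 < d) :
    ∃ c : ℝ, 0 < c ∧ ∀ t : ℝ, |t| ≤ Real.pi / d → ‖stepChar p t‖ ≤ Real.exp (-(c * t ^ 2)) := by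
  -- the deficit `1 - |χ(t)|` dominates `p k * (1 - cos (t k - θ))` for a suitable angle `θ`
  have hdef : ∀ t : ℝ, ∃ θ : ℝ, ∀ k : ℕ,
      (p k).toReal * (2 * Real.sin ((t * k - θ) / 2) ^ 2) ≤ 1 - ‖stepChar p t‖ := by
    intro t
    set S : ℂ := ∑' k, ((p k).toReal : ℂ) * Complex.exp (t * Complex.I) ^ k with hS
    have hnorm : ‖stepChar p t‖ = ‖S‖ := by
      rw [stepChar_eq_tsum, norm_mul, ← hS]
      rw [show (-(t * Complex.I) : ℂ) = ((-t : ℝ) : ℂ) * Complex.I by push_cast; ring,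
        Complex.norm_exp_ofReal_mul_I, one_mul]
    refine ⟨S.arg, fun k => ?_⟩
    have hsum : Summable fun k => ((p k).toReal : ℂ) * Complex.exp (t * Complex.I) ^ k := by
      refine Summable.of_norm ((summable_toReal p).congr fun k => ?_)
      rw [norm_mul, norm_pow, Complex.norm_exp_ofReal_mul_I]
      simp
    have h1 : HasSum (fun k : ℕ => (p k).toReal * Real.cos (t * k - S.arg)) ‖S‖ := by
      have h2 := (hsum.hasSum.mul_left (Complex.exp (-(S.arg * Complex.I))))
      rw [← hS] at h2
      have h3 : Complex.exp (-(S.arg * Complex.I)) * S = ‖S‖ := by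
        conv_lhs => rw [← Complex.norm_mul_exp_arg_mul_I S]
        rw [mul_left_comm, ← Complex.exp_add]
        simp
      rw [h3] at h2
      have h4 := Complex.hasSum_re h2
      rw [Complex.ofReal_re] at h4
      convert h4 using 1
      funext k
      rw [← Complex.exp_nat_mul, mul_left_comm, ← Complex.exp_add, Complex.re_ofReal_mul]
      rw [show (-(S.arg * Complex.I) + k * (t * Complex.I) : ℂ)
        = ((t * k - S.arg : ℝ) : ℂ) * Complex.I by push_cast; ring, Complex.exp_ofReal_mul_I_re]
    have h5 : HasSum (fun k => (p k).toReal) 1 := by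
      rw [← tsum_toReal p]; exact (summable_toReal p).hasSum
    have h6 := h5.sub h1
    rw [hnorm]
    have h7 : ∀ k : ℕ, (p k).toReal - (p k).toReal * Real.cos (t * k - S.arg)
        = (p k).toReal * (2 * Real.sin ((t * k - S.arg) / 2) ^ 2) := by
      intro k
      have : Real.cos (t * k - S.arg) = 1 - 2 * Real.sin ((t * k - S.arg) / 2) ^ 2 := by
        have h8 := Real.cos_two_mul ((t * k - S.arg) / 2)
        rw [Real.cos_sq'] at h8
        rw [show 2 * ((t * k - S.arg) / 2) = t * k - S.arg by ring] at h8
        linarith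
      rw [this]; ring
    simp_rw [h7] at h6
    exact le_hasSum h6 k fun i _ => by positivity
  let J : Ideal ℤ :=
    { carrier := {k | ∃ C : ℝ, 0 ≤ C ∧
        ∀ t : ℝ, |Real.sin (t * k / 2)| ≤ C * √(1 - ‖stepChar p t‖)}
      add_mem' := by
        rintro a b ⟨C, hC, ha⟩ ⟨D, hD, hb⟩
        refine ⟨C + D, by positivity, fun t => ?_⟩
        have h1 : Real.sin (t * (a + b : ℤ) / 2) = Real.sin (t * a / 2) * Real.cos (t * b / 2)
            + Real.cos (t * a / 2) * Real.sin (t * b / 2) := by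
          rw [← Real.sin_add]; congr 1; push_cast; ring
        rw [h1, add_mul]
        refine (abs_add_le _ _).trans (add_le_add ?_ ?_)
        · rw [abs_mul]
          exact (mul_le_of_le_one_right (abs_nonneg _) (Real.abs_cos_le_one _)).trans (ha t)
        · rw [abs_mul]
          exact (mul_le_of_le_one_left (abs_nonneg _) (Real.abs_cos_le_one _)).trans (hb t)
      zero_mem' := ⟨0, le_rfl, by simp⟩
      smul_mem' := by
        rintro n a ⟨C, hC, ha⟩
        have hsin : ∀ (n : ℕ) (x : ℝ), |Real.sin (n * x)| ≤ n * |Real.sin x| := by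
          intro n x
          induction n with
          | zero => simp
          | succ n ih =>
            push_cast
            rw [add_mul, one_mul, Real.sin_add, add_mul, one_mul]
            refine (abs_add_le _ _).trans (add_le_add ?_ ?_)
            · rw [abs_mul]
              exact (mul_le_of_le_one_right (abs_nonneg _) (Real.abs_cos_le_one _)).trans ih
            · rw [abs_mul]
              exact mul_le_of_le_one_left (abs_nonneg _) (Real.abs_cos_le_one _)
        refine ⟨n.natAbs * C, by positivity, fun t => ?_⟩
        rw [mul_assoc]
        refine le_trans ?_ (mul_le_mul_of_nonneg_left (ha t) (by positivity))
        refine le_trans (le_of_eq ?_) (hsin n.natAbs (t * a / 2))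
        rcases Int.natAbs_eq n with h | h
        · conv_lhs => rw [h]
          congr 2; push_cast; simp; ring
        · conv_lhs => rw [h]
          rw [← abs_neg, ← Real.sin_neg]
          congr 2; push_cast; simp; ring }
  have hsub : ((↑) : ℕ → ℤ) '' {k | p k ≠ 0} ⊆ J := by
    rintro _ ⟨k, hk, rfl⟩
    have pos : ∀ k, p k ≠ 0 → 0 < (p k).toReal := fun k hk =>
      ENNReal.toReal_pos hk (p.apply_ne_top k)
    have hpk := pos k hk
    have hp0 := pos 0 h0
    refine ⟨√(1 / (p k).toReal + 1 / (p 0).toReal), by positivity, fun t => ?_⟩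
    obtain ⟨θ, hθ⟩ := hdef t
    rw [← Real.sqrt_mul (by positivity)]
    refine Real.abs_le_sqrt ?_
    have h1 := hθ k
    have h2 := hθ 0
    have h3 : Real.sin (t * (k : ℤ) / 2) =
        Real.sin ((t * k - θ) / 2) * Real.cos (θ / 2)
          + Real.cos ((t * k - θ) / 2) * Real.sin (θ / 2) := by
      rw [← Real.sin_add]; congr 1; push_cast; ring
    have h4 : Real.sin ((t * (0 : ℕ) - θ) / 2) ^ 2 = Real.sin (θ / 2) ^ 2 := by
      rw [show (t * (0 : ℕ) - θ) / 2 = -(θ / 2) by push_cast; ring, Real.sin_neg, neg_sq]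
    rw [h4] at h2
    have h5 : Real.sin (t * (k : ℤ) / 2) ^ 2 ≤
        2 * Real.sin ((t * k - θ) / 2) ^ 2 + 2 * Real.sin (θ / 2) ^ 2 := by
      rw [h3]
      have e1 := Real.cos_sq_le_one (θ / 2)
      have e2 := Real.cos_sq_le_one ((t * k - θ) / 2)
      set u := Real.sin ((t * k - θ) / 2)
      set v := Real.cos (θ / 2)
      set x := Real.cos ((t * k - θ) / 2)
      set y := Real.sin (θ / 2)
      have e3 : u ^ 2 * v ^ 2 ≤ u ^ 2 := mul_le_of_le_one_right (sq_nonneg _) e1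
      have e4 : x ^ 2 * y ^ 2 ≤ y ^ 2 := mul_le_of_le_one_left (sq_nonneg _) e2
      nlinarith [sq_nonneg (u * v - x * y)]
    have h6 : 2 * Real.sin ((t * k - θ) / 2) ^ 2 ≤ 1 / (p k).toReal * (1 - ‖stepChar p t‖) := by
      rw [one_div, ← div_eq_inv_mul, le_div_iff₀ hpk]; linarith
    have h7 : 2 * Real.sin (θ / 2) ^ 2 ≤ 1 / (p 0).toReal * (1 - ‖stepChar p t‖) := by
      rw [one_div, ← div_eq_inv_mul, le_div_iff₀ hp0]; linarith
    linarith
  have hdJ : (d : ℤ) ∈ J := by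
    have h1 : (d : ℤ) ∈ Ideal.span {(d : ℤ)} := Ideal.mem_span_singleton_self _
    rw [hd, Nat.span_singleton_setGcd] at h1
    exact Ideal.span_le.2 hsub (hd ▸ h1)
  obtain ⟨C, hC, hdC⟩ := hdJ
  have hd1 : (0 : ℝ) < d := by exact_mod_cast hd0
  refine ⟨(d / (Real.pi * (C + 1))) ^ 2, by positivity, fun t ht => ?_⟩
  have h1 : |t| * d / Real.pi ≤ |Real.sin (t * d / 2)| := by
    have h2 : |t| * d ≤ Real.pi := (le_div_iff₀ hd1).1 ht
    have h3 := Real.mul_le_sin (x := |t| * d / 2) (by positivity) (by linarith)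
    have h4 : |Real.sin (t * d / 2)| = |Real.sin (|t| * d / 2)| := by
      rcases abs_choice t with h | h
      · rw [h]
      · rw [h, show -t * d / 2 = -(t * d / 2) by ring, Real.sin_neg, abs_neg]
    rw [h4]
    refine le_trans (le_of_eq ?_) (h3.trans (le_abs_self _))
    field_simp
  have hle : ‖stepChar p t‖ ≤ 1 := by
    obtain ⟨θ, hθ⟩ := hdef t
    have := hθ 0
    have h3 : 0 ≤ (p 0).toReal * (2 * Real.sin ((t * (0 : ℕ) - θ) / 2) ^ 2) := by positivity
    linarith
  have h2 : (|t| * d / Real.pi) ^ 2 ≤ (C + 1) ^ 2 * (1 - ‖stepChar p t‖) := by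
    have h3 : |t| * d / Real.pi ≤ (C + 1) * √(1 - ‖stepChar p t‖) := by
      refine h1.trans (le_trans (by simpa using hdC t) ?_)
      gcongr
      linarith
    calc (|t| * d / Real.pi) ^ 2 ≤ ((C + 1) * √(1 - ‖stepChar p t‖)) ^ 2 := by gcongr
      _ = _ := by rw [mul_pow, Real.sq_sqrt (by linarith)]
  have h3 : (d / (Real.pi * (C + 1))) ^ 2 * t ^ 2 ≤ 1 - ‖stepChar p t‖ := by
    rw [← div_le_iff₀' (by positivity)] at h2
    refine le_trans (le_of_eq ?_) h2
    rw [← sq_abs t]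
    field_simp
  have h4 := Real.add_one_le_exp (-((d / (Real.pi * (C + 1))) ^ 2 * t ^ 2))
  linarith

/-! ### The local limit theorem -/

/-- The variance of a step with law `p` and mean `1`. -/
def stepVar : ℝ := ∫ k : ℕ, ((k : ℝ) - 1) ^ 2 ∂p.toMeasure

theorem integrable_toMeasure_of_tsum_ne_top {f : ℕ → ℝ} (h : ∑' k, ‖f k‖ₑ * p k ≠ ∞) :
    Integrable f p.toMeasure := by
  refine ⟨by fun_prop, ?_⟩
  rw [HasFiniteIntegral, lintegral_countable']
  simpa [PMF.toMeasure_apply_singleton] using h.lt_top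

theorem integrable_natCast_pow (r : ℕ) (h : ∑' k : ℕ, (k : ℝ≥0∞) ^ r * p k ≠ ∞) :
    Integrable (fun k : ℕ => (k : ℝ) ^ r) p.toMeasure := by
  refine integrable_toMeasure_of_tsum_ne_top p ?_
  convert h using 4 with k
  simp [enorm_pow]

theorem integral_natCast (h : ∑' k : ℕ, (k : ℝ≥0∞) * p k = 1) :
    ∫ k : ℕ, (k : ℝ) ∂p.toMeasure = 1 := by
  have hi := integrable_natCast_pow p 1 (by simp [h])
  simp only [pow_one] at hi
  rw [integral_eq_lintegral_of_nonneg_ae (ae_of_all _ fun k => by positivity) (by fun_prop),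
    lintegral_countable']
  simp [PMF.toMeasure_apply_singleton, h]

theorem integrable_sub_one_sq (hmean : ∑' k : ℕ, (k : ℝ≥0∞) * p k = 1)
    (hsq : ∑' k : ℕ, (k : ℝ≥0∞) ^ 2 * p k ≠ ∞) :
    Integrable (fun k : ℕ => ((k : ℝ) - 1) ^ 2) p.toMeasure := by
  have h2 := integrable_natCast_pow p 2 hsq
  have h1 := integrable_natCast_pow p 1 (by simp [hmean])
  refine ((h2.sub (h1.const_mul 2)).add (integrable_const 1)).congr (ae_of_all _ fun k => ?_)
  simp; ring

theorem stepVar_pos (hmean : ∑' k : ℕ, (k : ℝ≥0∞) * p k = 1)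
    (hsq : ∑' k : ℕ, (k : ℝ≥0∞) ^ 2 * p k ≠ ∞) (h0 : p 0 ≠ 0) : 0 < stepVar p := by
  rw [stepVar, integral_pos_iff_support_of_nonneg (fun k => sq_nonneg _)
    (integrable_sub_one_sq p hmean hsq)]
  refine lt_of_lt_of_le ?_ (measure_mono (s := {0}) ?_)
  · rw [PMF.toMeasure_apply_singleton _ _ (measurableSet_singleton _)]
    exact pos_iff_ne_zero.2 h0
  · simp

/-- The central limit theorem for the characteristic functions of centred sums. -/
theorem tendsto_stepChar_pow (hmean : ∑' k : ℕ, (k : ℝ≥0∞) * p k = 1)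
    (hsq : ∑' k : ℕ, (k : ℝ≥0∞) ^ 2 * p k ≠ ∞) (h0 : p 0 ≠ 0) (s : ℝ) :
    Tendsto (fun m : ℕ => stepChar p (s / (√(stepVar p) * √m)) ^ m) atTop
      (𝓝 (Complex.exp (-s ^ 2 / 2))) := by
  have hv := stepVar_pos p hmean hsq h0
  set σ := √(stepVar p) with hσ
  have hσ0 : 0 < σ := Real.sqrt_pos.2 hv
  have h1 := integrable_natCast_pow p 1 (by simp [hmean])
  simp only [pow_one] at h1
  have key := tendsto_charFun_inv_sqrt_mul_pow (P := p.toMeasure)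
    (X := fun k : ℕ => σ⁻¹ * ((k : ℝ) - 1)) (by fun_prop) ?_ ?_ s
  · refine key.congr fun m => ?_
    congr 1
    have := charFun_map_mul_comp (μ := p.toMeasure) (f := fun k : ℕ => (k : ℝ) - 1)
      (by fun_prop) σ⁻¹ ((√m)⁻¹ * s)
    rw [this, stepChar]
    congr 1
    rw [div_eq_mul_inv, mul_inv]; ring
  · rw [integral_const_mul, integral_sub h1 (integrable_const _), integral_natCast p hmean]
    simp
  · simp only [Pi.pow_apply, mul_pow]
    rw [integral_const_mul]
    change σ⁻¹ ^ 2 * stepVar p = 1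
    rw [inv_pow, hσ, Real.sq_sqrt hv.le, inv_mul_cancel₀ hv.ne']

/-- Local limit theorem for lattice laws with mean `1`, for deviations that are small compared with
the standard deviation. -/
theorem exists_tendsto_sqrt_mul_stepMass (hmean : ∑' k : ℕ, (k : ℝ≥0∞) * p k = 1)
    (hsq : ∑' k : ℕ, (k : ℝ≥0∞) ^ 2 * p k ≠ ∞) (h0 : p 0 ≠ 0) (d : ℕ)
    (hd : d = Nat.setGcd {k | p k ≠ 0}) (hd0 : 0 < d) :
    ∃ C : ℝ, 0 < C ∧ ∀ ε > 0, ∃ δ > 0, ∃ M : ℕ, ∀ m ≥ M, ∀ j, d ∣ j →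
      |(j : ℝ) - m| ≤ δ * √m → |√m * stepMass p m j - C| ≤ ε := by
  have hv := stepVar_pos p hmean hsq h0
  set σ := √(stepVar p) with hσ
  have hσ0 : 0 < σ := Real.sqrt_pos.2 hv
  have hdd : (0 : ℝ) < d := by exact_mod_cast hd0
  have hdvd : ∀ k, p k ≠ 0 → d ∣ k := fun k hk => hd ▸ Nat.setGcd_dvd_of_mem hk
  obtain ⟨c, hc, hbound⟩ := exists_norm_stepChar_le p h0 d hd hd0
  -- the rescaled integrand, with `x` standing for `(j - m) / √m`
  let f : ℕ × ℝ → ℝ → ℂ := fun q =>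
    (Set.Ioc (-(Real.pi / d * (σ * √q.1))) (Real.pi / d * (σ * √q.1))).indicator fun s =>
      stepChar p (s / (σ * √q.1)) ^ q.1 * Complex.exp (-(s * (q.2 / σ) * Complex.I))
  have hcont : Continuous (stepChar p) := by
    unfold stepChar
    have : IsProbabilityMeasure (p.toMeasure.map fun k : ℕ => (k : ℝ) - 1) :=
      Measure.isProbabilityMeasure_map (by fun_prop)
    exact continuous_charFun
  have hf : ∀ m : ℕ, 0 < m → ∀ j, d ∣ j →
      ((√m * stepMass p m j : ℝ) : ℂ) = (d / (2 * Real.pi * σ) : ℝ) *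
        ∫ s, f (m, ((j : ℝ) - m) / √m) s := by
    intro m hm j hj
    have hm' : 0 < √(m : ℝ) := Real.sqrt_pos.2 (by exact_mod_cast hm)
    have hle : -(Real.pi / d * (σ * √m)) ≤ Real.pi / d * (σ * √m) := by
      have : 0 ≤ Real.pi / d * (σ * √m) := by positivity
      linarith
    simp only [f]
    rw [integral_indicator measurableSet_Ioc, ← intervalIntegral.integral_of_le hle]
    have h1 := intervalIntegral.integral_comp_div (a := -(Real.pi / d * (σ * √m)))
      (b := Real.pi / d * (σ * √m)) (c := σ * √m)
      (fun t : ℝ => stepChar p t ^ m * Complex.exp (-(t * ((j : ℝ) - m) * Complex.I)))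
      (by positivity)
    have h2 : ∀ s : ℝ, stepChar p (s / (σ * √m)) ^ m *
        Complex.exp (-(s * ((((j : ℝ) - m) / √m : ℝ) / σ) * Complex.I)) =
        stepChar p (s / (σ * √m)) ^ m *
          Complex.exp (-(((s / (σ * √m) : ℝ) : ℂ) * ((j : ℝ) - m) * Complex.I)) := by
      intro s
      congr 3
      push_cast
      field_simp
    simp_rw [h2]
    rw [h1, neg_div, mul_div_cancel_right₀ _ (by positivity)]
    push_cast
    rw [stepMass_eq_integral p hd0 hdvd m j hj, Complex.real_smul]
    have hσ' : (σ : ℂ) ≠ 0 := by exact_mod_cast hσ0.ne'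
    push_cast
    field_simp
    congr 1
    refine intervalIntegral.integral_congr fun t _ => ?_
    congr 3
    ring
  have hg : Integrable fun s : ℝ => Real.exp (-(c / σ ^ 2) * s ^ 2) :=
    integrable_exp_neg_mul_sq (by positivity)
  have hlim : Tendsto (fun q => ∫ s, f q s) (atTop ×ˢ 𝓝 (0 : ℝ))
      (𝓝 (∫ s : ℝ, Complex.exp (-s ^ 2 / 2))) := by
    refine tendsto_integral_filter_of_dominated_convergence _ ?_ ?_ hg ?_
    · refine Eventually.of_forall fun q => ?_
      refine (Continuous.aestronglyMeasurable ?_).indicator measurableSet_Ioc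
      exact ((hcont.comp (by fun_prop)).pow _).mul (by fun_prop)
    · have : ∀ᶠ q : ℕ × ℝ in atTop ×ˢ 𝓝 (0 : ℝ), 0 < q.1 :=
        (eventually_gt_atTop 0).prod_inl _
      filter_upwards [this] with q hq
      refine ae_of_all _ fun s => ?_
      have hm' : 0 < √(q.1 : ℝ) := Real.sqrt_pos.2 (by exact_mod_cast hq)
      simp only [f]
      by_cases hs : s ∈ Set.Ioc (-(Real.pi / d * (σ * √q.1))) (Real.pi / d * (σ * √q.1))
      · rw [Set.indicator_of_mem hs, norm_mul, norm_pow]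
        have h1 : ‖Complex.exp (-(s * (q.2 / σ) * Complex.I))‖ = 1 := by
          rw [show (-(s * (q.2 / σ) * Complex.I) : ℂ) = ((-(s * (q.2 / σ)) : ℝ) : ℂ) * Complex.I by
            push_cast; ring, Complex.norm_exp_ofReal_mul_I]
        rw [h1, mul_one]
        have h2 : |s / (σ * √q.1)| ≤ Real.pi / d := by
          rw [abs_div, abs_of_pos (by positivity : 0 < σ * √q.1), div_le_iff₀ (by positivity)]
          exact abs_le.2 ⟨hs.1.le, hs.2⟩
        refine (pow_le_pow_left₀ (norm_nonneg _) (hbound _ h2) _).trans (le_of_eq ?_)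
        rw [← Real.exp_nat_mul]
        congr 1
        have h3 : √(q.1 : ℝ) ^ 2 = q.1 := Real.sq_sqrt (by positivity)
        rw [div_pow, mul_pow, h3]
        have : (q.1 : ℝ) ≠ 0 := by exact_mod_cast hq.ne'
        field_simp
      · rw [Set.indicator_of_notMem hs, norm_zero]
        positivity
    · refine ae_of_all _ fun s => ?_
      have h1 : Tendsto (fun q : ℕ × ℝ => stepChar p (s / (σ * √q.1)) ^ q.1 *
          Complex.exp (-(s * (q.2 / σ) * Complex.I))) (atTop ×ˢ 𝓝 (0 : ℝ))
          (𝓝 (Complex.exp (-s ^ 2 / 2) * 1)) := by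
        refine ((tendsto_stepChar_pow p hmean hsq h0 s).comp tendsto_fst).mul ?_
        have : Continuous fun x : ℝ => Complex.exp (-(s * (x / σ) * Complex.I)) := by fun_prop
        have h2 := (this.tendsto 0).comp (tendsto_snd (f := (atTop : Filter ℕ)) (g := 𝓝 (0 : ℝ)))
        simpa [Function.comp_def] using h2
      rw [mul_one] at h1
      refine h1.congr' ?_
      have h2 : Tendsto (fun q : ℕ × ℝ => Real.pi / d * (σ * √q.1)) (atTop ×ˢ 𝓝 (0 : ℝ)) atTop := by
        refine Tendsto.const_mul_atTop (by positivity) (Tendsto.const_mul_atTop hσ0 ?_)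
        exact (Real.tendsto_sqrt_atTop.comp tendsto_natCast_atTop_atTop).comp tendsto_fst
      filter_upwards [h2.eventually_gt_atTop |s|] with q hq
      simp only [f]
      rw [Set.indicator_of_mem]
      exact ⟨(abs_lt.1 hq).1, (abs_lt.1 hq).2.le⟩
  have hI : ∫ s : ℝ, Complex.exp (-s ^ 2 / 2) = (√(2 * Real.pi) : ℝ) := by
    have h1 : ∀ s : ℝ, Complex.exp (-s ^ 2 / 2) = ((Real.exp (-(1 / 2) * s ^ 2) : ℝ) : ℂ) := by
      intro s; push_cast; congr 1; ring
    simp_rw [h1]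
    rw [integral_complex_ofReal, integral_gaussian]
    congr 2; ring
  rw [hI] at hlim
  refine ⟨d / (2 * Real.pi * σ) * √(2 * Real.pi), by positivity, fun ε hε => ?_⟩
  have hlim2 := hlim.const_mul ((d / (2 * Real.pi * σ) : ℝ) : ℂ)
  have h1 := (Metric.tendsto_nhds.1 hlim2) ε hε
  rw [(atTop_basis.prod Metric.nhds_basis_closedBall).eventually_iff] at h1
  obtain ⟨⟨M, δ⟩, ⟨-, hδ⟩, h2⟩ := h1
  refine ⟨δ, hδ, max M 1, fun m hm j hj hjm => ?_⟩
  have hm1 : 0 < m := by omega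
  have hm' : 0 < √(m : ℝ) := Real.sqrt_pos.2 (by exact_mod_cast hm1)
  have h3 := @h2 (m, ((j : ℝ) - m) / √m) ⟨Set.mem_Ici.2 (by omega), by
    rw [Metric.mem_closedBall, dist_zero_right, Real.norm_eq_abs, abs_div, abs_of_pos hm',
      div_le_iff₀ hm']
    exact hjm⟩
  rw [← hf m hm1 j hj, ← Complex.ofReal_mul, Complex.dist_eq, ← Complex.ofReal_sub,
    Complex.norm_real] at h3
  exact h3.le

end LocalLimit

/-! ### Tilting a weight sequence to mean one -/

section Tilting

variable (w : ℕ → ℝ≥0)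

/-- The series `∑_{k ≥ 1} (k - 1) ω_k t^k`. It compares `t φ'(t)` with `φ(t)`, and does so
without subtraction: `t φ'(t) + ω_0 = φ(t) + excess t`. -/
def excess (t : ℝ≥0∞) : ℝ≥0∞ := ∑' k : ℕ, ((k - 1 : ℕ) : ℝ≥0∞) * ((w k : ℝ≥0∞) * t ^ k)

variable {w}

theorem mul_phiDeriv (t : ℝ≥0∞) :
    t * phiDeriv w t = ∑' k : ℕ, (k : ℝ≥0∞) * ((w k : ℝ≥0∞) * t ^ k) := by
  rw [phiDeriv, ← ENNReal.tsum_mul_left]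
  refine tsum_congr fun k => ?_
  cases k with
  | zero => simp
  | succ k => rw [Nat.add_sub_cancel, pow_succ]; ring

theorem mul_phiDeriv_add (t : ℝ≥0∞) :
    t * phiDeriv w t + w 0 = phi w t + excess w t := by
  have h : (w 0 : ℝ≥0∞) = ∑' k : ℕ, if k = 0 then (w 0 : ℝ≥0∞) else 0 :=
    (tsum_ite_eq 0 fun _ => (w 0 : ℝ≥0∞)).symm
  rw [mul_phiDeriv, h, phi, excess, ← ENNReal.tsum_add, ← ENNReal.tsum_add]
  refine tsum_congr fun k => ?_
  cases k with
  | zero => simp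
  | succ k => simp; ring

theorem phi_mono {s t : ℝ≥0∞} (h : s ≤ t) : phi w s ≤ phi w t :=
  ENNReal.tsum_le_tsum fun k => by gcongr

theorem excess_mono {s t : ℝ≥0∞} (h : s ≤ t) : excess w s ≤ excess w t :=
  ENNReal.tsum_le_tsum fun k => by gcongr

theorem le_phi (t : ℝ≥0∞) : (w 0 : ℝ≥0∞) ≤ phi w t := by
  have := ENNReal.le_tsum (f := fun k => (w k : ℝ≥0∞) * t ^ k) 0
  simpa [phi] using this

theorem phi_ne_zero (h0 : 0 < w 0) (t : ℝ≥0∞) : phi w t ≠ 0 :=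
  ((ENNReal.coe_pos.2 h0).trans_le (le_phi t)).ne'

/-- Chebyshev's sum inequality: the tilted means increase with the parameter. -/
theorem mul_phiDeriv_mul_phi_le {s t : ℝ≥0∞} (h : s ≤ t) :
    s * phiDeriv w s * phi w t ≤ t * phiDeriv w t * phi w s := by
  let a : ℕ × ℕ → ℝ≥0∞ := fun x =>
    ((x.1 : ℝ≥0∞) * ((w x.1 : ℝ≥0∞) * s ^ x.1)) * ((w x.2 : ℝ≥0∞) * t ^ x.2)
  let b : ℕ × ℕ → ℝ≥0∞ := fun x =>
    ((x.2 : ℝ≥0∞) * ((w x.2 : ℝ≥0∞) * t ^ x.2)) * ((w x.1 : ℝ≥0∞) * s ^ x.1)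
  have ha : s * phiDeriv w s * phi w t = ∑' x, a x := by
    rw [mul_phiDeriv, phi, ENNReal.tsum_prod']
    simp_rw [a, ENNReal.tsum_mul_left, ENNReal.tsum_mul_right]
  have hb : t * phiDeriv w t * phi w s = ∑' x, b x := by
    rw [mul_phiDeriv, phi, ENNReal.tsum_prod']
    simp_rw [b, ENNReal.tsum_mul_right, ENNReal.tsum_mul_left]
  have key : ∀ i j : ℕ, i ≤ j → a (i, j) + a (j, i) ≤ b (i, j) + b (j, i) := by
    intro i j hij
    obtain ⟨e, rfl⟩ := Nat.exists_eq_add_of_le hij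
    have h1 : s ^ (i + e) * t ^ i ≤ s ^ i * t ^ (i + e) := by
      calc s ^ (i + e) * t ^ i = s ^ i * t ^ i * s ^ e := by ring
        _ ≤ s ^ i * t ^ i * t ^ e := by gcongr
        _ = _ := by ring
    simp only [a, b]
    push_cast
    calc _ = (w i : ℝ≥0∞) * w (i + e) *
          (i * (s ^ i * t ^ (i + e) + s ^ (i + e) * t ^ i) + e * (s ^ (i + e) * t ^ i)) := by ring
      _ ≤ (w i : ℝ≥0∞) * w (i + e) *
          (i * (s ^ i * t ^ (i + e) + s ^ (i + e) * t ^ i) + e * (s ^ i * t ^ (i + e))) := by gcongr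
      _ = _ := by ring
  have hsym : ∀ x : ℕ × ℕ, a x + a x.swap ≤ b x + b x.swap := by
    rintro ⟨i, j⟩
    rcases le_total i j with h | h
    · exact key i j h
    · rw [add_comm (a _), add_comm (b _)]; exact key j i h
  have h2 := ENNReal.tsum_le_tsum hsym
  have ea : ∑' x : ℕ × ℕ, a x.swap = ∑' x, a x := (Equiv.prodComm ℕ ℕ).tsum_eq a
  have eb : ∑' x : ℕ × ℕ, b x.swap = ∑' x, b x := (Equiv.prodComm ℕ ℕ).tsum_eq b
  rw [ENNReal.tsum_add, ENNReal.tsum_add, ea, eb, ← two_mul, ← two_mul] at h2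
  rw [ha, hb]
  exact (ENNReal.mul_le_mul_iff_right (by simp) (by simp)).1 h2

theorem psi_le_psi (h0 : 0 < w 0) {s t : ℝ≥0∞} (h : s ≤ t) (ht : phi w t ≠ ∞) :
    psi w s ≤ psi w t := by
  have hs : phi w s ≠ ∞ := ne_top_of_le_ne_top ht (phi_mono h)
  rw [psi, psi, ENNReal.div_le_iff (phi_ne_zero h0 s) hs, ENNReal.mul_comm_div,
    ← mul_div_assoc, ENNReal.le_div_iff_mul_le (Or.inl (phi_ne_zero h0 t)) (Or.inl ht)]
  exact mul_phiDeriv_mul_phi_le h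

/-- Inside the disc of convergence the terms `k ω_k t^k` are summable. -/
theorem summable_mul_pow {t : ℝ≥0} (ht : (t : ℝ≥0∞) < rho w) :
    Summable fun k : ℕ => (k : ℝ) * ((w k : ℝ) * (t : ℝ) ^ k) := by
  obtain ⟨r, htr, hr⟩ := ENNReal.lt_iff_exists_nnreal_btwn.1 ht
  obtain ⟨C, hC, hle⟩ := (FormalMultilinearSeries.ofScalars ℝ
    (fun k => (w k : ℝ))).norm_mul_pow_le_of_lt_radius hr
  have htr' : (t : ℝ) < r := by exact_mod_cast htr
  have hr0 : (0 : ℝ) < r := lt_of_le_of_lt t.2 htr'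
  have hq : ‖(t / r : ℝ)‖ < 1 := by
    rw [Real.norm_of_nonneg (by positivity), div_lt_one hr0]; exact htr'
  refine ((summable_pow_mul_geometric_of_norm_lt_one 1 hq).mul_left C).of_nonneg_of_le
    (fun k => by positivity) fun k => ?_
  have h1 := hle k
  rw [FormalMultilinearSeries.ofScalars_norm] at h1
  simp only [Real.norm_eq_abs, NNReal.abs_eq] at h1
  calc (k : ℝ) * ((w k : ℝ) * (t : ℝ) ^ k)
      = (w k * r ^ k) * (k * (t / r) ^ k) := by rw [div_pow]; field_simp
    _ ≤ C * (k * (t / r) ^ k) := by gcongr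
    _ = _ := by rw [pow_one]

theorem mul_phiDeriv_ne_top {t : ℝ≥0∞} (ht : t < rho w) : t * phiDeriv w t ≠ ∞ := by
  lift t to ℝ≥0 using ht.ne_top
  have h := summable_mul_pow ht
  rw [mul_phiDeriv]
  have h2 : Summable fun k : ℕ => (k : ℝ≥0) * (w k * t ^ k) := by exact_mod_cast h
  have := ENNReal.tsum_coe_ne_top_iff_summable.2 h2
  push_cast at this
  exact this

theorem phi_add_excess_ne_top {t : ℝ≥0∞} (ht : t < rho w) : phi w t + excess w t ≠ ∞ := by
  rw [← mul_phiDeriv_add]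
  exact ENNReal.add_ne_top.2 ⟨mul_phiDeriv_ne_top ht, ENNReal.coe_ne_top⟩

theorem phi_ne_top {t : ℝ≥0∞} (ht : t < rho w) : phi w t ≠ ∞ :=
  (ENNReal.add_ne_top.1 (phi_add_excess_ne_top ht)).1

theorem excess_ne_top {t : ℝ≥0∞} (ht : t < rho w) : excess w t ≠ ∞ :=
  (ENNReal.add_ne_top.1 (phi_add_excess_ne_top ht)).2

theorem psi_le_one_iff (h0 : 0 < w 0) {t : ℝ≥0∞} (ht : phi w t ≠ ∞) :
    psi w t ≤ 1 ↔ excess w t ≤ w 0 := by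
  have h1 : (w 0 : ℝ≥0∞) ≠ ∞ := ENNReal.coe_ne_top
  rw [psi, ENNReal.div_le_iff (phi_ne_zero h0 t) ht, one_mul,
    ← ENNReal.add_le_add_iff_right h1, mul_phiDeriv_add, ENNReal.add_le_add_iff_left ht]

theorem mul_phiDeriv_eq_phi_iff {t : ℝ≥0∞} (ht : phi w t ≠ ∞) :
    t * phiDeriv w t = phi w t ↔ excess w t = w 0 := by
  rw [← ENNReal.add_left_inj (a := (w 0 : ℝ≥0∞)) ENNReal.coe_ne_top, mul_phiDeriv_add,
    ENNReal.add_right_inj ht]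

theorem psi_eq_one_iff (h0 : 0 < w 0) {t : ℝ≥0∞} (ht : phi w t ≠ ∞) :
    psi w t = 1 ↔ excess w t = w 0 := by
  rw [psi, ENNReal.div_eq_one_iff (phi_ne_zero h0 t) ht, mul_phiDeriv_eq_phi_iff ht]

theorem excess_lt_excess (h2 : ∃ m, 2 ≤ m ∧ 0 < w m) {s t : ℝ≥0∞} (h : s < t)
    (hs : excess w s ≠ ∞) : excess w s < excess w t := by
  obtain ⟨m, hm, hwm⟩ := h2
  refine ENNReal.tsum_lt_tsum (i := m) hs (fun k => by gcongr) ?_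
  have h1 : ((m - 1 : ℕ) : ℝ≥0∞) ≠ 0 := by
    have : m - 1 ≠ 0 := by omega
    exact_mod_cast this
  rw [ENNReal.mul_lt_mul_iff_right h1 (by simp),
    ENNReal.mul_lt_mul_iff_right (by simpa using hwm.ne') (by simp)]
  exact ENNReal.pow_lt_pow_left (by omega) h

theorem tendsto_psi_nu (h0 : 0 < w 0) (hρ : rho w ≠ 0) :
    Tendsto (psi w) (𝓝[<] (rho w)) (𝓝 (nu w)) ∧ ∀ t < rho w, psi w t ≤ nu w := by
  have hmono : MonotoneOn (psi w) (Set.Iio (rho w)) := fun s _ t ht hst =>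
    psi_le_psi h0 hst (phi_ne_top ht)
  have h1 := hmono.tendsto_nhdsLT (OrderTop.bddAbove _)
  have hne : (𝓝[<] (rho w)).NeBot := nhdsLT_neBot_of_exists_lt ⟨0, pos_iff_ne_zero.2 hρ⟩
  have h2 : nu w = sSup (psi w '' Set.Iio (rho w)) := by
    rw [nu, if_neg hρ, h1.limUnder_eq]
  rw [h2]
  exact ⟨h1, fun t ht => le_sSup ⟨t, ht, rfl⟩⟩

/-- The intermediate value theorem for `excess` below the radius of convergence. -/
theorem exists_excess_eq (h0 : 0 < w 0) {t : ℝ≥0∞} (ht : t < rho w)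
    (hlt : (w 0 : ℝ≥0∞) ≤ excess w t) :
    ∃ s ≤ t, excess w s = w 0 := by
  lift t to ℝ≥0 using ht.ne_top
  let H : ℝ → ℝ := fun x => ∑' k : ℕ, ((k - 1 : ℕ) : ℝ) * ((w k : ℝ) * x ^ k)
  have hcont : ContinuousOn H (Set.Icc 0 (t : ℝ)) := by
    refine continuousOn_tsum (fun k => by fun_prop) (summable_mul_pow ht) fun k x hx => ?_
    have hx0 := hx.1
    rw [Real.norm_of_nonneg (by positivity)]
    gcongr
    · omega
    · exact hx.2
  have hH : ∀ x : ℝ≥0, (x : ℝ) ≤ t → ENNReal.ofReal (H x) = excess w x := by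
    intro x hx
    have hx' : (x : ℝ≥0∞) < rho w := lt_of_le_of_lt (by exact_mod_cast hx) ht
    have hf := excess_ne_top hx'
    have e : ∀ k : ℕ, ((k - 1 : ℕ) : ℝ) * ((w k : ℝ) * (x : ℝ) ^ k) =
        (((k - 1 : ℕ) : ℝ≥0∞) * ((w k : ℝ≥0∞) * (x : ℝ≥0∞) ^ k)).toReal := by
      intro k; rw [ENNReal.toReal_mul, ENNReal.toReal_natCast]; simp
    simp only [H]
    simp_rw [e]
    rw [← ENNReal.tsum_toReal_eq (ENNReal.ne_top_of_tsum_ne_top hf)]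
    exact ENNReal.ofReal_toReal hf
  have h1 : (w 0 : ℝ) ∈ Set.Icc (H 0) (H t) := by
    constructor
    · have : H 0 = 0 := by
        simp only [H]
        refine (tsum_congr fun k => ?_).trans tsum_zero
        cases k <;> simp
      rw [this]; exact (w 0).2
    · have := hH t le_rfl
      rw [← this] at hlt
      rw [← ENNReal.ofReal_coe_nnreal] at hlt
      exact (ENNReal.ofReal_le_ofReal_iff' .. |>.1 hlt).resolve_right (by
        have : (0 : ℝ) < w 0 := h0
        linarith)
  obtain ⟨x, hx, hx2⟩ := intermediate_value_Icc t.2 hcont h1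
  lift x to ℝ≥0 using hx.1
  refine ⟨x, ENNReal.coe_le_coe.2 hx.2, ?_⟩
  rw [← hH x hx.2, hx2, ENNReal.ofReal_coe_nnreal]

/-- If `ν = 1`, the value `1` is attained at the radius of convergence, where `φ` is finite. -/
theorem of_nu_eq_one (h0 : 0 < w 0) (h2 : ∃ m, 2 ≤ m ∧ 0 < w m) (hν : nu w = 1) :
    rho w ≠ ∞ ∧ phi w (rho w) ≠ ∞ ∧ excess w (rho w) = w 0 := by
  have hρ0 : rho w ≠ 0 := by
    intro h
    rw [nu, if_pos h] at hν
    simp at hν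
  obtain ⟨hlim, hle⟩ := tendsto_psi_nu h0 hρ0
  have hne : (𝓝[<] (rho w)).NeBot := nhdsLT_neBot_of_exists_lt ⟨0, pos_iff_ne_zero.2 hρ0⟩
  have hex : ∀ t < rho w, excess w t ≤ w 0 := fun t ht =>
    (psi_le_one_iff h0 (phi_ne_top ht)).1 (hν ▸ hle t ht)
  have hρ : rho w ≠ ∞ := by
    intro htop
    obtain ⟨m, hm, hwm⟩ := h2
    obtain ⟨N, hN⟩ := exists_nat_gt ((w 0 / w m : ℝ≥0) + 1)
    have h1 := hex (N : ℝ≥0∞) (by rw [htop]; simp)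
    have h3 := (ENNReal.le_tsum
      (f := fun k : ℕ => ((k - 1 : ℕ) : ℝ≥0∞) * ((w k : ℝ≥0∞) * (N : ℝ≥0∞) ^ k)) m).trans h1
    have h4 : ((m - 1 : ℕ) : ℝ≥0) * (w m * (N : ℝ≥0) ^ m) ≤ w 0 := by exact_mod_cast h3
    have h5 : (1 : ℝ≥0) ≤ ((m - 1 : ℕ) : ℝ≥0) := by
      have : 1 ≤ m - 1 := by omega
      exact_mod_cast this
    have hN1 : (1 : ℝ≥0) ≤ N := le_trans (by simp) hN.le
    have h6 : (N : ℝ≥0) ≤ (N : ℝ≥0) ^ m := le_self_pow₀ hN1 (by omega)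
    have h7 : w m * N ≤ w 0 := by
      calc w m * N ≤ 1 * (w m * (N : ℝ≥0) ^ m) := by rw [one_mul]; gcongr
        _ ≤ _ := mul_le_mul_left h5 _
        _ ≤ w 0 := h4
    have h8 : (N : ℝ≥0) ≤ w 0 / w m := by
      rw [le_div_iff₀ hwm, mul_comm]; exact h7
    exact absurd (hN.trans_le (h8.trans (by simp))) (lt_irrefl _)
  have hexρ : excess w (rho w) ≤ w 0 := by
    refine ENNReal.summable.tsum_le_of_sum_le fun s => ?_
    have hc : Continuous fun t : ℝ≥0∞ =>
        ∑ k ∈ s, ((k - 1 : ℕ) : ℝ≥0∞) * ((w k : ℝ≥0∞) * t ^ k) := by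
      refine continuous_finsetSum _ fun k _ => ?_
      exact (ENNReal.continuous_const_mul (by simp)).comp
        ((ENNReal.continuous_const_mul (by simp)).comp (ENNReal.continuous_pow k))
    refine le_of_tendsto (x := 𝓝[<] (rho w)) ((hc.tendsto (rho w)).mono_left nhdsWithin_le_nhds) ?_
    filter_upwards [self_mem_nhdsWithin] with t ht
    exact (ENNReal.sum_le_tsum s).trans (hex t ht)
  have hφ : phi w (rho w) ≠ ∞ := by
    have h1 : phi w (rho w) ≤ w 0 + w 1 * rho w + excess w (rho w) := by
      have e : ((w 0 : ℝ≥0∞) + w 1 * rho w) =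
          ∑' k : ℕ, if k < 2 then (w k : ℝ≥0∞) * rho w ^ k else 0 := by
        rw [tsum_eq_sum (s := Finset.range 2)]
        · simp [Finset.sum_range_succ]
        · intro k hk
          rw [if_neg (by simpa using hk)]
      rw [e, excess, ← ENNReal.tsum_add]
      refine ENNReal.tsum_le_tsum fun k => ?_
      split_ifs with hk
      · exact le_self_add
      · rw [zero_add]
        refine le_mul_of_one_le_left (by simp) ?_
        have : 1 ≤ k - 1 := by omega
        exact_mod_cast this
    refine ne_top_of_le_ne_top ?_ h1
    refine ENNReal.add_ne_top.2 ⟨ENNReal.add_ne_top.2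
      ⟨by simp, ENNReal.mul_ne_top (by simp) hρ⟩, ?_⟩
    exact ne_top_of_le_ne_top (by simp) hexρ
  refine ⟨hρ, hφ, le_antisymm hexρ ?_⟩
  by_contra! hlt
  -- otherwise `ψ ≤ 1 - (ω_0 - excess ρ) / φ(ρ) < 1` on `[0, ρ)`
  set δ := (w 0 : ℝ≥0∞) - excess w (rho w) with hδ
  have hδ0 : δ ≠ 0 := (tsub_pos_of_lt hlt).ne'
  have hψ : ∀ t < rho w, psi w t + δ / phi w (rho w) ≤ 1 := by
    intro t ht
    have hφt := phi_ne_top ht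
    have h1 : t * phiDeriv w t + δ ≤ phi w t := by
      have h3 : t * phiDeriv w t + δ + excess w (rho w) ≤ phi w t + excess w (rho w) := by
        rw [add_assoc, hδ, tsub_add_cancel_of_le hexρ, mul_phiDeriv_add]
        gcongr
        exact excess_mono ht.le
      exact (ENNReal.add_le_add_iff_right (ne_top_of_le_ne_top (by simp) hexρ)).1 h3
    calc psi w t + δ / phi w (rho w) ≤ psi w t + δ / phi w t := by
          gcongr
          exact phi_mono ht.le
      _ = (t * phiDeriv w t + δ) / phi w t := by rw [psi, ENNReal.add_div]
      _ ≤ 1 := ENNReal.div_le_of_le_mul (by rwa [one_mul])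
  have h3 : nu w + δ / phi w (rho w) ≤ 1 :=
    le_of_tendsto (hlim.add_const _) (by
      filter_upwards [self_mem_nhdsWithin] with t ht using hψ t ht)
  rw [hν] at h3
  have h4 : δ / phi w (rho w) ≠ 0 := ENNReal.div_ne_zero.2 ⟨hδ0, hφ⟩
  exact absurd h3 (not_le.2 (ENNReal.lt_add_right ENNReal.one_ne_top h4))

/-- For `ν ≥ 1` the tilting parameter `τ` is finite, `φ(τ)` is finite, and `τ φ'(τ) = φ(τ)`. -/
theorem tau_spec (h0 : 0 < w 0) (h2 : ∃ m, 2 ≤ m ∧ 0 < w m) (hν : 1 ≤ nu w) :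
    tau w ≠ ∞ ∧ phi w (tau w) ≠ ∞ ∧ excess w (tau w) = w 0 := by
  have hρ0 : rho w ≠ 0 := by
    intro h
    rw [nu, if_pos h] at hν
    simp at hν
  obtain ⟨hlim, hle⟩ := tendsto_psi_nu h0 hρ0
  have hne : (𝓝[<] (rho w)).NeBot := nhdsLT_neBot_of_exists_lt ⟨0, pos_iff_ne_zero.2 hρ0⟩
  have htau : tau w = sInf {t | t ≤ rho w ∧ psiExt w t = 1} := by rw [tau, if_pos hν]
  rcases hν.eq_or_lt with h1 | h1
  · obtain ⟨ha, hb, hc⟩ := of_nu_eq_one h0 h2 h1.symm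
    have hset : {t | t ≤ rho w ∧ psiExt w t = 1} = {rho w} := by
      ext t
      simp only [Set.mem_ofPred_eq, Set.mem_singleton_iff]
      constructor
      · rintro ⟨htρ, ht⟩
        by_contra hne
        have hlt := lt_of_le_of_ne htρ hne
        rw [psiExt, if_pos hlt, psi_eq_one_iff h0 (phi_ne_top hlt)] at ht
        have := excess_lt_excess h2 hlt (excess_ne_top hlt)
        rw [ht, hc] at this
        exact lt_irrefl _ this
      · rintro rfl
        exact ⟨le_rfl, by rw [psiExt, if_neg (lt_irrefl _), ← h1]⟩
    rw [htau, hset, sInf_singleton]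
    exact ⟨ha, hb, hc⟩
  · obtain ⟨t, ht, htψ⟩ : ∃ t < rho w, 1 < psi w t := by
      by_contra! hcon
      refine absurd (le_of_tendsto hlim ?_) (not_le.2 h1)
      filter_upwards [self_mem_nhdsWithin] with t ht using hcon t ht
    have hex : (w 0 : ℝ≥0∞) ≤ excess w t := by
      by_contra! hcon
      exact absurd ((psi_le_one_iff h0 (phi_ne_top ht)).2 hcon.le) (not_le.2 htψ)
    obtain ⟨s, hs, hse⟩ := exists_excess_eq h0 ht hex
    have hsρ : s < rho w := lt_of_le_of_lt hs ht
    have hset : {t | t ≤ rho w ∧ psiExt w t = 1} = {s} := by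
      ext u
      simp only [Set.mem_ofPred_eq, Set.mem_singleton_iff]
      constructor
      · rintro ⟨huρ, hu⟩
        have hlt : u < rho w := by
          by_contra hcon
          rw [psiExt, if_neg hcon] at hu
          exact h1.ne' hu
        rw [psiExt, if_pos hlt, psi_eq_one_iff h0 (phi_ne_top hlt)] at hu
        rcases lt_trichotomy u s with h | h | h
        · have := excess_lt_excess h2 h (excess_ne_top hlt)
          rw [hu, hse] at this
          exact absurd this (lt_irrefl _)
        · exact h
        · have := excess_lt_excess h2 h (excess_ne_top hsρ)
          rw [hu, hse] at this
          exact absurd this (lt_irrefl _)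
      · rintro rfl
        exact ⟨hsρ.le, by rw [psiExt, if_pos hsρ]; exact (psi_eq_one_iff h0 (phi_ne_top hsρ)).2 hse⟩
    rw [htau, hset, sInf_singleton]
    exact ⟨hsρ.ne_top, phi_ne_top hsρ, hse⟩

theorem tau_ne_zero (h0 : 0 < w 0) (h2 : ∃ m, 2 ≤ m ∧ 0 < w m) (hν : 1 ≤ nu w) : tau w ≠ 0 := by
  intro h
  have h1 := (tau_spec h0 h2 hν).2.2
  rw [h] at h1
  have : excess w 0 = 0 := by
    rw [excess, ENNReal.tsum_eq_zero]
    intro k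
    cases k <;> simp
  rw [this] at h1
  exact h0.ne (by exact_mod_cast h1)

theorem ofWeights_apply {α : Type*} [Inhabited α] {f : α → ℝ≥0∞} (h0 : tsum f ≠ 0)
    (h1 : tsum f ≠ ∞) (a : α) : ofWeights f a = f a / tsum f := by
  rw [ofWeights, dif_pos ⟨h0, h1⟩, PMF.normalize_apply, div_eq_mul_inv]

theorem offspring_apply (h0 : 0 < w 0) (h2 : ∃ m, 2 ≤ m ∧ 0 < w m) (hν : 1 ≤ nu w) (k : ℕ) :
    offspring w k = w k * tau w ^ k / phi w (tau w) :=
  ofWeights_apply (phi_ne_zero h0 _) (tau_spec h0 h2 hν).2.1 k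

theorem offspring_ne_zero_iff (h0 : 0 < w 0) (h2 : ∃ m, 2 ≤ m ∧ 0 < w m) (hν : 1 ≤ nu w) (k : ℕ) :
    offspring w k ≠ 0 ↔ 0 < w k := by
  have := (tau_spec h0 h2 hν).2.1
  rw [offspring_apply h0 h2 hν]
  simp [ENNReal.div_eq_zero_iff, this, tau_ne_zero h0 h2 hν, pos_iff_ne_zero]

theorem span_eq_setGcd_offspring (h0 : 0 < w 0) (h2 : ∃ m, 2 ≤ m ∧ 0 < w m) (hν : 1 ≤ nu w) :
    span w = Nat.setGcd {k | offspring w k ≠ 0} := by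
  rw [span]
  congr 1
  ext k
  exact (offspring_ne_zero_iff h0 h2 hν k).symm

theorem span_pos (h2 : ∃ m, 2 ≤ m ∧ 0 < w m) : 0 < span w := by
  rw [span, Nat.pos_iff_ne_zero, ne_eq, Nat.setGcd_eq_zero_iff]
  obtain ⟨m, hm, hwm⟩ := h2
  intro h
  have : m = 0 := h hwm
  omega

theorem tsum_mul_offspring (h0 : 0 < w 0) (h2 : ∃ m, 2 ≤ m ∧ 0 < w m) (hν : 1 ≤ nu w) :
    ∑' k : ℕ, (k : ℝ≥0∞) * offspring w k = 1 := by
  obtain ⟨-, hφ, hex⟩ := tau_spec h0 h2 hν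
  have h1 := (mul_phiDeriv_eq_phi_iff hφ).2 hex
  simp_rw [offspring_apply h0 h2 hν, ← mul_div_assoc, div_eq_mul_inv]
  rw [ENNReal.tsum_mul_right, ← mul_phiDeriv, h1, ENNReal.mul_inv_cancel (phi_ne_zero h0 _) hφ]

theorem tsum_sq_mul_offspring_ne_top (hI : TypeIAlpha w) :
    ∑' k : ℕ, (k : ℝ≥0∞) ^ 2 * offspring w k ≠ ∞ := by
  have h1 := (evariance_lt_top_iff_memLp (by fun_prop)).1 hI.2
  have h2 := (memLp_two_iff_integrable_sq (by fun_prop)).1 h1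
  have h3 := h2.2
  rw [HasFiniteIntegral, lintegral_countable'] at h3
  convert h3.ne using 4 with k
  · simp [enorm_pow]
  · simp [PMF.toMeasure_apply_singleton]

end Tilting

/-! ### Generating series of weighted plane trees -/

namespace PlaneTree

/-- A plane tree is the same as the sequence of the subtrees attached to its root. -/
def equivSigma : PlaneTree ≃ Σ d : ℕ, (Fin d → PlaneTree) where
  toFun | node d c => ⟨d, c⟩
  invFun x := node x.1 x.2
  left_inv | node _ _ => rfl
  right_inv _ := rfl

theorem tsum_eq (f : PlaneTree → ℝ≥0∞) :
    ∑' T, f T = ∑' d : ℕ, ∑' c : Fin d → PlaneTree, f (node d c) := by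
  rw [← equivSigma.symm.tsum_eq f, ENNReal.tsum_sigma']
  rfl

/-- The embedding of plane trees into a `W`-type. -/
def toWType : PlaneTree → WType fun d : ℕ => Fin d
  | node d c => WType.mk d fun i => (c i).toWType

theorem toWType_injective : Function.Injective toWType := by
  intro S
  induction S with
  | node d c ih =>
    rintro ⟨d', c'⟩ h
    simp only [toWType, WType.mk.injEq] at h
    obtain ⟨rfl, h⟩ := h
    congr 1
    funext i
    exact ih i (congrFun (eq_of_heq h) i)

instance : Countable PlaneTree := toWType_injective.countable

/-- The subtree of the vertices of height at most `k`. -/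
def truncate : ℕ → PlaneTree → PlaneTree
  | 0, _ => node 0 Fin.elim0
  | k + 1, node d c => node d fun i => truncate k (c i)

/-- The number of vertices of height `k`. -/
def levelCard : ℕ → PlaneTree → ℕ
  | 0, _ => 1
  | k + 1, node _ c => ∑ i, levelCard k (c i)

/-- The number of vertices of height less than `k`. -/
def lowCard : ℕ → PlaneTree → ℕ
  | 0, _ => 0
  | k + 1, node _ c => 1 + ∑ i, lowCard k (c i)

/-- The probability that a Galton-Watson tree with offspring law `p` equals the given tree. -/
def mass (p : PMF ℕ) : PlaneTree → ℝ≥0∞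
  | node d c => p d * ∏ i, (c i).mass p

/-- The probability that the truncation at height `k` of a Galton-Watson tree with offspring law `p`
equals the given tree; it vanishes unless the tree has height at most `k`. -/
def truncMass (p : PMF ℕ) : ℕ → PlaneTree → ℝ≥0∞
  | 0, node d _ => if d = 0 then 1 else 0
  | k + 1, node d c => p d * ∏ i, truncMass p k (c i)

theorem size_pos (T : PlaneTree) : 0 < T.size := by
  cases T; simp [size]

end PlaneTree

section GeneratingSeries

open PowerSeries (coeff)

/-- Products of weighted generating series enumerate tuples by their total size. -/
theorem coeff_prod_mk_tsum {X : Type*} (s : X → ℕ) {d : ℕ} (a : Fin d → X → ℝ≥0∞) (n : ℕ) :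
    coeff n (∏ i, PowerSeries.mk fun m => ∑' x, if s x = m then a i x else 0) =
      ∑' c : Fin d → X, if ∑ i, s (c i) = n then ∏ i, a i (c i) else 0 := by
  induction d generalizing n with
  | zero => simp [PowerSeries.coeff_one, tsum_fintype, eq_comm]
  | succ d ih =>
    rw [Fin.prod_univ_succ, PowerSeries.coeff_mul,
      ← (Fin.consEquiv fun _ => X).tsum_eq, ENNReal.tsum_prod']
    simp_rw [ih, PowerSeries.coeff_mk, ← ENNReal.tsum_mul_right, ← ENNReal.tsum_mul_left]
    rw [← Summable.tsum_finsetSum fun _ _ => ENNReal.summable]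
    refine tsum_congr fun x => ?_
    rw [← Summable.tsum_finsetSum fun _ _ => ENNReal.summable]
    refine tsum_congr fun c => ?_
    simp only [Fin.consEquiv, Equiv.coe_fn_mk, Fin.sum_univ_succ, Fin.prod_univ_succ, Fin.cons_zero,
      Fin.cons_succ]
    split_ifs with h
    · rw [Finset.sum_eq_single (s x, ∑ i, s (c i))]
      · simp
      · rintro ⟨i, j⟩ _ hne
        by_cases h1 : s x = i
        · have : ∑ i, s (c i) ≠ j := fun h2 => hne (by simp [h1, h2])
          simp [this]
        · simp [h1]
      · intro hmem
        exact absurd (Finset.HasAntidiagonal.mem_antidiagonal.2 h) hmem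
    · refine (Finset.sum_eq_zero ?_)
      rintro ⟨i, j⟩ hij
      by_cases h1 : s x = i
      · have : ∑ i, s (c i) ≠ j := fun h2 =>
          h (by rw [h1, h2]; exact Finset.HasAntidiagonal.mem_antidiagonal.1 hij)
        simp [this]
      · simp [h1]

variable (p : PMF ℕ)

/-- The series whose `n`-th coefficient is the total mass of the plane trees with `n` vertices. -/
def treeSeries : PowerSeries ℝ≥0∞ :=
  PowerSeries.mk fun n => ∑' T : PlaneTree, if T.size = n then T.mass p else 0

theorem coeff_zero_treeSeries : coeff 0 (treeSeries p) = 0 := by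
  rw [treeSeries, PowerSeries.coeff_mk, ENNReal.tsum_eq_zero]
  intro T
  rw [if_neg T.size_pos.ne']

theorem coeff_succ_treeSeries (n : ℕ) :
    coeff (n + 1) (treeSeries p) = ∑' d, p d * coeff n (treeSeries p ^ d) := by
  rw [treeSeries, PowerSeries.coeff_mk, PlaneTree.tsum_eq]
  refine tsum_congr fun d => ?_
  have h := coeff_prod_mk_tsum PlaneTree.size (fun _ : Fin d => PlaneTree.mass p) n
  rw [Finset.prod_const, Finset.card_univ, Fintype.card_fin] at h
  rw [h, ← ENNReal.tsum_mul_left]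
  refine tsum_congr fun c => ?_
  simp only [PlaneTree.size, PlaneTree.mass, mul_ite, mul_zero]
  congr 1
  rw [eq_iff_iff]
  omega

theorem coeff_treeSeries_pow_of_lt {m l : ℕ} (h : m < l) : coeff m (treeSeries p ^ l) = 0 := by
  have h1 : (PowerSeries.X : PowerSeries ℝ≥0∞) ∣ treeSeries p := by
    rw [PowerSeries.X_dvd_iff, ← PowerSeries.coeff_zero_eq_constantCoeff_apply,
      coeff_zero_treeSeries]
  exact PowerSeries.X_pow_dvd_iff.1 (pow_dvd_pow_of_dvd h1 l) m h

/-- Exploring the root of the first tree of a forest. -/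
theorem coeff_succ_treeSeries_pow_succ (m l : ℕ) :
    coeff (m + 1) (treeSeries p ^ (l + 1)) = ∑' d, p d * coeff m (treeSeries p ^ (l + d)) := by
  simp_rw [pow_succ (treeSeries p) l, pow_add]
  rw [PowerSeries.coeff_mul, Finset.Nat.sum_antidiagonal_succ', coeff_zero_treeSeries, mul_zero,
    zero_add]
  simp_rw [PowerSeries.coeff_mul, coeff_succ_treeSeries, Finset.mul_sum, ← ENNReal.tsum_mul_left]
  rw [← Summable.tsum_finsetSum fun _ _ => ENNReal.summable]
  refine tsum_congr fun d => Finset.sum_congr rfl fun x _ => ?_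
  ring

theorem coe_stepMass (m j : ℕ) :
    (stepMass p m j : ℝ≥0∞) = coeff j ((PowerSeries.mk fun k => p k) ^ m) := by
  have h : (PowerSeries.mk fun k => p k) = PowerSeries.map ENNReal.ofNNRealHom (genSeries p) := by
    ext k
    simp [genSeries, ENNReal.coe_toNNReal (p.apply_ne_top k)]
  rw [h, ← map_pow, PowerSeries.coeff_map]
  rfl

/-- Differentiating the `(m+1)`-st power of the generating series of a step. -/
theorem mul_sum_stepMass (m j : ℕ) :
    (m + 1 : ℝ≥0∞) * ∑ x ∈ Finset.HasAntidiagonal.antidiagonal j,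
      (stepMass p m x.1 : ℝ≥0∞) * (x.2 * p x.2) = j * stepMass p (m + 1) j := by
  cases j with
  | zero => simp
  | succ j =>
    have h1 : coeff j (PowerSeries.derivative ℝ≥0∞ ((PowerSeries.mk fun k => p k) ^ (m + 1))) =
        (m + 1 : ℝ≥0∞) * ∑ x ∈ Finset.HasAntidiagonal.antidiagonal j,
          (stepMass p m x.1 : ℝ≥0∞) * ((x.2 + 1) * p (x.2 + 1)) := by
      rw [PowerSeries.derivative_pow, Nat.add_sub_cancel, mul_assoc]
      have e : ((m + 1 : ℕ) : PowerSeries ℝ≥0∞) = PowerSeries.C ((m + 1 : ℕ) : ℝ≥0∞) := by simp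
      rw [e, PowerSeries.coeff_C_mul, PowerSeries.coeff_mul]
      push_cast
      congr 1
      refine Finset.sum_congr rfl fun x _ => ?_
      rw [PowerSeries.coeff_derivative, PowerSeries.coeff_mk, coe_stepMass]
      ring
    rw [PowerSeries.coeff_derivative, ← coe_stepMass] at h1
    rw [Finset.Nat.sum_antidiagonal_succ']
    push_cast
    rw [zero_mul, mul_zero, zero_add, ← h1]
    ring

/-- The Otter-Dwass formula: the mass of the forests of `l` trees with `l + j` vertices in terms of
the random walk with step law `p`. -/
theorem mul_coeff_treeSeries_pow (l j : ℕ) :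
    ((l + j : ℕ) : ℝ≥0∞) * coeff (l + j) (treeSeries p ^ l) = l * stepMass p (l + j) j := by
  obtain ⟨m, hm⟩ : ∃ m, m = l + j := ⟨_, rfl⟩
  rw [← hm]
  induction m generalizing l j with
  | zero =>
    obtain rfl : l = 0 := by omega
    simp
  | succ m ih =>
    cases l with
    | zero => simp [PowerSeries.coeff_one]
    | succ l =>
      have hsum : coeff (m + 1) (treeSeries p ^ (l + 1)) =
          ∑ x ∈ Finset.HasAntidiagonal.antidiagonal j,
            p x.2 * coeff m (treeSeries p ^ (l + x.2)) := by
        rw [coeff_succ_treeSeries_pow_succ, tsum_eq_sum (s := Finset.range (j + 1))]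
        · rw [Finset.Nat.sum_antidiagonal_eq_sum_range_succ_mk,
            ← Finset.sum_range_reflect]
          refine Finset.sum_congr rfl fun i hi => ?_
          simp
        · intro d hd
          rw [coeff_treeSeries_pow_of_lt, mul_zero]
          simp at hd
          omega
      rcases Nat.eq_zero_or_pos m with rfl | hmpos
      · obtain ⟨rfl, rfl⟩ : l = 0 ∧ j = 0 := by omega
        rw [hsum]
        simp [coe_stepMass]
      · have hm0 : (m : ℝ≥0∞) ≠ 0 := by exact_mod_cast hmpos.ne'
        -- the induction hypothesis carries a factor `m`
        refine (ENNReal.mul_right_inj hm0 (ENNReal.natCast_ne_top m)).1 ?_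
        have h1 : (m : ℝ≥0∞) * coeff (m + 1) (treeSeries p ^ (l + 1)) =
            l * stepMass p (m + 1) j + ∑ x ∈ Finset.HasAntidiagonal.antidiagonal j,
              (stepMass p m x.1 : ℝ≥0∞) * (x.2 * p x.2) := by
          rw [hsum, Finset.mul_sum]
          have h2 : (stepMass p (m + 1) j : ℝ≥0∞) =
              ∑ x ∈ Finset.HasAntidiagonal.antidiagonal j, (stepMass p m x.1 : ℝ≥0∞) * p x.2 := by
            rw [stepMass_succ]
            push_cast
            refine Finset.sum_congr rfl fun x _ => ?_
            rw [ENNReal.coe_toNNReal (p.apply_ne_top _)]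
          rw [h2, Finset.mul_sum, ← Finset.sum_add_distrib]
          refine Finset.sum_congr rfl fun x hx => ?_
          have hx' := Finset.HasAntidiagonal.mem_antidiagonal.1 hx
          have := ih (l + x.2) x.1 (by omega)
          rw [mul_left_comm, this]
          push_cast
          ring
        calc (m : ℝ≥0∞) * (((m + 1 : ℕ) : ℝ≥0∞) * coeff (m + 1) (treeSeries p ^ (l + 1)))
            = ((m + 1 : ℕ) : ℝ≥0∞) * (m * coeff (m + 1) (treeSeries p ^ (l + 1))) := by ring
          _ = ((m + 1) * l + j) * stepMass p (m + 1) j := by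
              rw [h1, mul_add]
              push_cast
              rw [mul_sum_stepMass]
              ring
          _ = m * (((l + 1 : ℕ) : ℝ≥0∞) * stepMass p (m + 1) j) := by
              rw [← mul_assoc]
              congr 1
              have : (m + 1) * l + j = m * (l + 1) := by
                have : m = l + j := by omega
                subst this; ring
              exact_mod_cast this

/-- The trees with a given truncation at height `k` arise from it by attaching a forest to the
vertices of height `k`. -/
theorem mk_tsum_truncate_eq (k : ℕ) (t : PlaneTree) :
    (PowerSeries.mk fun n => ∑' T : PlaneTree, if T.size = n then
      (open Classical in if T.truncate k = t then T.mass p else 0) else 0) =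
    PowerSeries.C (t.truncMass p k) * PowerSeries.X ^ t.lowCard k *
      treeSeries p ^ t.levelCard k := by
  classical
  induction k generalizing t with
  | zero =>
    obtain ⟨d, c⟩ := t
    by_cases hd : d = 0
    · subst hd
      have : ∀ T : PlaneTree, T.truncate 0 = PlaneTree.node 0 c := fun T => by
        simp only [PlaneTree.truncate]
        congr 1
        exact Subsingleton.elim _ _
      simp [this, PlaneTree.truncMass, PlaneTree.lowCard, PlaneTree.levelCard, treeSeries]
    · have : ∀ T : PlaneTree, T.truncate 0 ≠ PlaneTree.node d c := fun T h => by
        simp only [PlaneTree.truncate, PlaneTree.node.injEq] at h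
        exact hd h.1.symm
      ext n
      simp [this, PlaneTree.truncMass, hd]
  | succ k ih =>
    obtain ⟨d, c⟩ := t
    have hprod : PowerSeries.C ((PlaneTree.node d c).truncMass p (k + 1)) *
        PowerSeries.X ^ (PlaneTree.node d c).lowCard (k + 1) *
          treeSeries p ^ (PlaneTree.node d c).levelCard (k + 1) =
        PowerSeries.C (p d) * PowerSeries.X * ∏ i, PowerSeries.mk fun n => ∑' T : PlaneTree,
          if T.size = n then if T.truncate k = c i then T.mass p else 0 else 0 := by
      simp_rw [ih]
      simp only [PlaneTree.truncMass, PlaneTree.lowCard, PlaneTree.levelCard, map_mul, map_prod,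
        Finset.prod_mul_distrib, Finset.prod_pow_eq_pow_sum, pow_add, pow_one]
      ring
    rw [hprod]
    ext n
    rw [PowerSeries.coeff_mk, PlaneTree.tsum_eq, tsum_eq_single d]
    · cases n with
      | zero =>
        have h1 : ∀ c' : Fin d → PlaneTree, (PlaneTree.node d c').size ≠ 0 :=
          fun c' => (PlaneTree.size_pos _).ne'
        simp only [h1, if_false, tsum_zero]
        rw [mul_assoc, PowerSeries.coeff_C_mul, PowerSeries.coeff_zero_X_mul, mul_zero]
      | succ n =>
        rw [mul_assoc, PowerSeries.coeff_C_mul, PowerSeries.coeff_succ_X_mul,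
          coeff_prod_mk_tsum PlaneTree.size
            (fun i T => if T.truncate k = c i then T.mass p else 0), ← ENNReal.tsum_mul_left]
        refine tsum_congr fun c' => ?_
        have h1 : (PlaneTree.node d c').size = n + 1 ↔ ∑ i, (c' i).size = n := by
          simp only [PlaneTree.size]; omega
        have h2 : (PlaneTree.node d c').truncate (k + 1) = PlaneTree.node d c ↔
            ∀ i, (c' i).truncate k = c i := by
          simp [PlaneTree.truncate, funext_iff]
        simp only [h1, h2, mul_ite, mul_zero]
        by_cases h3 : ∑ i, (c' i).size = n
        · rw [if_pos h3, if_pos h3]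
          by_cases h4 : ∀ i, (c' i).truncate k = c i
          · simp [h4, PlaneTree.mass]
          · rw [if_neg h4]
            push Not at h4
            obtain ⟨i, hi⟩ := h4
            rw [Finset.prod_eq_zero (Finset.mem_univ i) (if_neg hi), mul_zero]
        · rw [if_neg h3, if_neg h3]
    · intro d' hd'
      rw [ENNReal.tsum_eq_zero]
      intro c'
      have : (PlaneTree.node d' c').truncate (k + 1) ≠ PlaneTree.node d c := by
        intro h
        simp only [PlaneTree.truncate, PlaneTree.node.injEq] at h
        exact hd' h.1
      simp [this]

theorem tsum_truncate_eq (k : ℕ) (t : PlaneTree) (m : ℕ) :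
    (∑' T : PlaneTree, if T.size = t.lowCard k + m then
      (open Classical in if T.truncate k = t then T.mass p else 0) else 0) =
    t.truncMass p k * coeff m (treeSeries p ^ t.levelCard k) := by
  have h := congrArg (coeff (t.lowCard k + m)) (mk_tsum_truncate_eq p k t)
  rw [PowerSeries.coeff_mk, mul_assoc, PowerSeries.coeff_C_mul, add_comm,
    PowerSeries.coeff_X_pow_mul, add_comm] at h
  exact h

end GeneratingSeries

/-! ### Moments of the generation sizes -/

section Moments

theorem tsum_fin_succ {X : Type*} {d : ℕ} (f : (Fin (d + 1) → X) → ℝ≥0∞) :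
    ∑' c, f c = ∑' x, ∑' c : Fin d → X, f (Fin.cons x c) := by
  rw [← (Fin.consEquiv fun _ => X).tsum_eq, ENNReal.tsum_prod']
  rfl

variable {X : Type*} {q : X → ℝ≥0∞}

theorem tsum_prod_eq_one (hq : ∑' x, q x = 1) (d : ℕ) :
    ∑' c : Fin d → X, ∏ i, q (c i) = 1 := by
  induction d with
  | zero => simp [tsum_fintype]
  | succ d ih =>
    rw [tsum_fin_succ]
    simp [Fin.prod_univ_succ, ENNReal.tsum_mul_left, ih, hq]

theorem tsum_prod_mul_sum (hq : ∑' x, q x = 1) (f : X → ℝ≥0∞) (d : ℕ) :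
    ∑' c : Fin d → X, (∏ i, q (c i)) * ∑ i, f (c i) = d * ∑' x, q x * f x := by
  induction d with
  | zero => simp
  | succ d ih =>
    rw [tsum_fin_succ]
    have h : ∀ x (c : Fin d → X), (∏ i, q ((Fin.cons x c : Fin (d + 1) → X) i)) *
        ∑ i, f ((Fin.cons x c : Fin (d + 1) → X) i) =
        (q x * f x) * ∏ i, q (c i) + q x * ((∏ i, q (c i)) * ∑ i, f (c i)) := by
      intro x c
      simp only [Fin.prod_univ_succ, Fin.sum_univ_succ, Fin.cons_zero, Fin.cons_succ]
      ring
    simp_rw [h, ENNReal.tsum_add, ENNReal.tsum_mul_left, tsum_prod_eq_one hq, ih,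
      ENNReal.tsum_mul_right, hq]
    push_cast
    ring

theorem tsum_prod_mul_sum_mul_sum (hq : ∑' x, q x = 1) (f g : X → ℝ≥0∞) (d : ℕ) :
    ∑' c : Fin d → X, (∏ i, q (c i)) * ((∑ i, f (c i)) * ∑ i, g (c i)) =
      d * ∑' x, q x * (f x * g x) +
        ((d * (d - 1) : ℕ) : ℝ≥0∞) * ((∑' x, q x * f x) * ∑' x, q x * g x) := by
  induction d with
  | zero => simp
  | succ d ih =>
    rw [tsum_fin_succ]
    have h : ∀ x (c : Fin d → X), (∏ i, q ((Fin.cons x c : Fin (d + 1) → X) i)) *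
        ((∑ i, f ((Fin.cons x c : Fin (d + 1) → X) i)) *
          ∑ i, g ((Fin.cons x c : Fin (d + 1) → X) i)) =
        (q x * (f x * g x)) * ∏ i, q (c i) +
        (q x * f x) * ((∏ i, q (c i)) * ∑ i, g (c i)) +
        (q x * g x) * ((∏ i, q (c i)) * ∑ i, f (c i)) +
        q x * ((∏ i, q (c i)) * ((∑ i, f (c i)) * ∑ i, g (c i))) := by
      intro x c
      simp only [Fin.prod_univ_succ, Fin.sum_univ_succ, Fin.cons_zero, Fin.cons_succ]
      ring
    simp_rw [h, ENNReal.tsum_add, ENNReal.tsum_mul_left, tsum_prod_eq_one hq,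
      tsum_prod_mul_sum hq, ih, ENNReal.tsum_mul_right, hq]
    have : (d + 1) * (d + 1 - 1) = d * (d - 1) + 2 * d := by
      cases d
      · rfl
      · simp only [Nat.add_sub_cancel]; ring
    rw [this]
    push_cast
    ring

variable (p : PMF ℕ)

/-- The second factorial moment of `p`; it is the variance if `p` has mean `1`. -/
def factMoment : ℝ≥0∞ := ∑' d : ℕ, p d * ((d * (d - 1) : ℕ) : ℝ≥0∞)

theorem factMoment_ne_top (hsq : ∑' k : ℕ, (k : ℝ≥0∞) ^ 2 * p k ≠ ∞) : factMoment p ≠ ∞ := by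
  refine ne_top_of_le_ne_top hsq (ENNReal.tsum_le_tsum fun d => ?_)
  rw [mul_comm]
  gcongr
  rw [sq]
  push_cast
  gcongr
  exact tsub_le_self

namespace PlaneTree

theorem tsum_truncMass_zero (f : PlaneTree → ℝ≥0∞) :
    ∑' t : PlaneTree, t.truncMass p 0 * f t = f (node 0 Fin.elim0) := by
  rw [tsum_eq_single (node 0 Fin.elim0)]
  · simp [truncMass]
  · rintro ⟨d, c⟩ hne
    have : d ≠ 0 := by
      rintro rfl
      exact hne (by congr 1; exact Subsingleton.elim _ _)
    simp [truncMass, this]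

theorem tsum_truncMass_succ (k : ℕ) (f : PlaneTree → ℝ≥0∞) :
    ∑' t : PlaneTree, t.truncMass p (k + 1) * f t = ∑' d, p d *
      ∑' c : Fin d → PlaneTree, (∏ i, (c i).truncMass p k) * f (node d c) := by
  rw [tsum_eq]
  simp only [truncMass, mul_assoc, ENNReal.tsum_mul_left]

theorem tsum_truncMass (k : ℕ) : ∑' t : PlaneTree, t.truncMass p k = 1 := by
  induction k with
  | zero => simpa using tsum_truncMass_zero p fun _ => 1
  | succ k ih =>
    have := tsum_truncMass_succ p k fun _ => 1
    simp only [mul_one, tsum_prod_eq_one ih, p.tsum_coe] at this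
    exact this

variable {p}

theorem tsum_truncMass_mul_levelCard (hmean : ∑' k : ℕ, (k : ℝ≥0∞) * p k = 1) (k : ℕ) :
    ∑' t : PlaneTree, t.truncMass p k * (t.levelCard k : ℝ≥0∞) = 1 := by
  induction k with
  | zero => rw [tsum_truncMass_zero p fun t => (t.levelCard 0 : ℝ≥0∞)]; simp [levelCard]
  | succ k ih =>
    rw [tsum_truncMass_succ p k fun t => (t.levelCard (k + 1) : ℝ≥0∞)]
    simp only [levelCard, Nat.cast_sum]
    simp_rw [tsum_prod_mul_sum (tsum_truncMass p k) (fun t => (t.levelCard k : ℝ≥0∞)), ih, mul_one,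
      mul_comm (p _), hmean]

theorem tsum_truncMass_mul_lowCard (hmean : ∑' k : ℕ, (k : ℝ≥0∞) * p k = 1) (k : ℕ) :
    ∑' t : PlaneTree, t.truncMass p k * (t.lowCard k : ℝ≥0∞) = k := by
  induction k with
  | zero => rw [tsum_truncMass_zero p fun t => (t.lowCard 0 : ℝ≥0∞)]; simp [lowCard]
  | succ k ih =>
    rw [tsum_truncMass_succ p k fun t => (t.lowCard (k + 1) : ℝ≥0∞)]
    simp only [lowCard, Nat.cast_sum, Nat.cast_add, Nat.cast_one, mul_add, mul_one,
      ENNReal.tsum_add]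
    simp_rw [tsum_prod_mul_sum (tsum_truncMass p k) (fun t => (t.lowCard k : ℝ≥0∞)), ih,
      tsum_prod_eq_one (tsum_truncMass p k), mul_one, ← mul_assoc, ENNReal.tsum_mul_right,
      mul_comm (p _), hmean, p.tsum_coe, one_mul]
    ring

theorem tsum_truncMass_mul_levelCard_sq (hmean : ∑' k : ℕ, (k : ℝ≥0∞) * p k = 1) (k : ℕ) :
    ∑' t : PlaneTree, t.truncMass p k * ((t.levelCard k : ℝ≥0∞) * t.levelCard k) =
      1 + k * factMoment p := by
  induction k with
  | zero =>
    rw [tsum_truncMass_zero p fun t => (t.levelCard 0 : ℝ≥0∞) * t.levelCard 0]; simp [levelCard]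
  | succ k ih =>
    rw [tsum_truncMass_succ p k fun t => (t.levelCard (k + 1) : ℝ≥0∞) * t.levelCard (k + 1)]
    simp only [levelCard, Nat.cast_sum]
    simp_rw [tsum_prod_mul_sum_mul_sum (tsum_truncMass p k) (fun t => (t.levelCard k : ℝ≥0∞))
      (fun t => (t.levelCard k : ℝ≥0∞)), ih, tsum_truncMass_mul_levelCard hmean, mul_one, mul_add,
      ← mul_assoc, ENNReal.tsum_add, ENNReal.tsum_mul_right, mul_comm (p _) (Nat.cast _)]
    simp only [hmean, mul_one, one_mul, factMoment, mul_comm (p _)]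
    push_cast
    ring

/-- Under the size-biased law the mean number of vertices of height less than `k` grows at most
quadratically in `k`. -/
theorem tsum_truncMass_mul_levelCard_mul_lowCard_le (hmean : ∑' k : ℕ, (k : ℝ≥0∞) * p k = 1)
    (k : ℕ) :
    ∑' t : PlaneTree, t.truncMass p k * ((t.levelCard k : ℝ≥0∞) * t.lowCard k) ≤
      k + k * k * factMoment p := by
  induction k with
  | zero =>
    rw [tsum_truncMass_zero p fun t => (t.levelCard 0 : ℝ≥0∞) * t.lowCard 0]; simp [lowCard]
  | succ k ih =>
    rw [tsum_truncMass_succ p k fun t => (t.levelCard (k + 1) : ℝ≥0∞) * t.lowCard (k + 1)]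
    have h1 : ∀ d, ∑' c : Fin d → PlaneTree, (∏ i, (c i).truncMass p k) *
        (((node d c).levelCard (k + 1) : ℝ≥0∞) * (node d c).lowCard (k + 1)) =
        d + (d * (∑' t : PlaneTree, t.truncMass p k * ((t.levelCard k : ℝ≥0∞) * t.lowCard k)) +
          ((d * (d - 1) : ℕ) : ℝ≥0∞) * k) := by
      intro d
      simp only [levelCard, lowCard, Nat.cast_sum, Nat.cast_add, Nat.cast_one, mul_add, mul_one,
        ENNReal.tsum_add]
      rw [tsum_prod_mul_sum_mul_sum (tsum_truncMass p k) (fun t => (t.levelCard k : ℝ≥0∞))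
        (fun t => (t.lowCard k : ℝ≥0∞)),
        tsum_prod_mul_sum (tsum_truncMass p k) (fun t => (t.levelCard k : ℝ≥0∞)),
        tsum_truncMass_mul_levelCard hmean, tsum_truncMass_mul_lowCard hmean, mul_one, one_mul]
    simp_rw [h1]
    have h2 : ∑' d : ℕ, p d * (d : ℝ≥0∞) = 1 := by simp_rw [mul_comm (p _)]; exact hmean
    simp_rw [mul_add, ← mul_assoc, ENNReal.tsum_add, ENNReal.tsum_mul_right, h2, one_mul]
    change 1 + (_ + factMoment p * k) ≤ _
    calc 1 + (_ + factMoment p * k)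
        ≤ 1 + ((k + k * k * factMoment p) + factMoment p * k) := by
          gcongr
          simpa only [mul_assoc] using ih
      _ ≤ 1 + ((k + k * k * factMoment p) + factMoment p * k) + (k + 1) * factMoment p :=
          le_self_add
      _ = _ := by push_cast; ring

end PlaneTree

end Moments

/-! ### Vertices of a plane tree -/

theorem mem_vertices_nil (D : Vertex → ℕ∞) : [] ∈ vertices D := by
  intro u i h
  simp at h

theorem mem_vertices_of_prefix {D : Vertex → ℕ∞} {x y : Vertex} (h : x <+: y)
    (hy : y ∈ vertices D) : x ∈ vertices D :=
  fun u i hu => hy u i (hu.trans h)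

theorem mem_vertices_append_singleton {D : Vertex → ℕ∞} {x : Vertex} {i : ℕ} :
    x ++ [i] ∈ vertices D ↔ x ∈ vertices D ∧ (i : ℕ∞) < D x := by
  constructor
  · exact fun h => ⟨mem_vertices_of_prefix (List.prefix_append _ _) h, h x i List.prefix_rfl⟩
  · rintro ⟨h1, h2⟩ u j hu
    rcases List.prefix_concat_iff.1 hu with h | h
    · obtain ⟨h3, h4⟩ := List.append_inj' h rfl
      rwa [h3, List.singleton_inj.1 h4]
    · exact h1 u j h

theorem mem_vertices_cons {D : Vertex → ℕ∞} {x : Vertex} {i : ℕ} :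
    i :: x ∈ vertices D ↔ (i : ℕ∞) < D [] ∧ x ∈ vertices fun u => D (i :: u) := by
  constructor
  · intro h
    refine ⟨h [] i (by simp), fun u j hu => h (i :: u) j ?_⟩
    simpa using hu
  · rintro ⟨h1, h2⟩ u j hu
    cases u with
    | nil =>
      have : j = i := by simpa using hu
      rwa [this]
    | cons a u =>
      simp only [List.cons_append, List.cons_prefix_cons] at hu
      obtain ⟨rfl, hu⟩ := hu
      exact h2 u j hu

namespace PlaneTree

theorem outdegree_ne_top (t : PlaneTree) (x : Vertex) : t.outdegree x ≠ ⊤ := by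
  induction x generalizing t with
  | nil => cases t; simp [outdegree]
  | cons i x ih =>
    cases t
    simp only [outdegree]
    split_ifs
    · exact ih _
    · simp

theorem cons_mem_vertices_node {d : ℕ} {c : Fin d → PlaneTree} {i : ℕ} {x : Vertex} :
    i :: x ∈ vertices (node d c).outdegree ↔
      ∃ h : i < d, x ∈ vertices (c ⟨i, h⟩).outdegree := by
  rw [mem_vertices_cons]
  simp only [outdegree, Nat.cast_lt]
  constructor
  · rintro ⟨h, hx⟩
    exact ⟨h, by simpa [h] using hx⟩
  · rintro ⟨h, hx⟩
    exact ⟨h, by simpa [h] using hx⟩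

theorem outdegree_eq_zero {t : PlaneTree} {x : Vertex} (h : x ∉ vertices t.outdegree) :
    t.outdegree x = 0 := by
  induction x generalizing t with
  | nil => exact absurd (mem_vertices_nil _) h
  | cons i x ih =>
    obtain ⟨d, c⟩ := t
    rw [cons_mem_vertices_node] at h
    simp only [outdegree]
    split_ifs with hi
    · exact ih fun hx => h ⟨hi, hx⟩
    · rfl

theorem outdegree_truncate {k : ℕ} {t : PlaneTree} {x : Vertex} (h : x.length < k) :
    (t.truncate k).outdegree x = t.outdegree x := by
  induction k generalizing t x with
  | zero => simp at h
  | succ k ih =>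
    obtain ⟨d, c⟩ := t
    cases x with
    | nil => rfl
    | cons i x =>
      simp only [truncate, outdegree]
      split_ifs
      · exact ih (by simpa using h)
      · rfl

/-- Prepending a letter, as an embedding of the vertices of a subtree attached to the root. -/
def consEmb (i : ℕ) : Vertex ↪ Vertex := ⟨List.cons i, List.cons_injective⟩

/-- The vertices of height less than `k`. -/
def lowVerts : ℕ → PlaneTree → Finset Vertex
  | 0, _ => ∅
  | k + 1, node d c =>
      insert [] (Finset.univ.biUnion fun i : Fin d => (lowVerts k (c i)).map (consEmb i))

/-- The vertices of height `k`. -/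
def levelVerts : ℕ → PlaneTree → Finset Vertex
  | 0, _ => {[]}
  | k + 1, node d c => Finset.univ.biUnion fun i : Fin d => (levelVerts k (c i)).map (consEmb i)

theorem mem_lowVerts {k : ℕ} {t : PlaneTree} {x : Vertex} :
    x ∈ lowVerts k t ↔ x ∈ vertices t.outdegree ∧ x.length < k := by
  induction k generalizing t x with
  | zero => simp [lowVerts]
  | succ k ih =>
    obtain ⟨d, c⟩ := t
    cases x with
    | nil => simp [lowVerts, mem_vertices_nil]
    | cons i x =>
      simp only [lowVerts, Finset.mem_insert, reduceCtorEq, false_or, Finset.mem_biUnion,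
        Finset.mem_univ, true_and, Finset.mem_map, ih, cons_mem_vertices_node, List.length_cons,
        Nat.add_lt_add_iff_right]
      constructor
      · rintro ⟨a, y, ⟨h1, h2⟩, h3⟩
        obtain ⟨rfl, rfl⟩ := List.cons.inj h3
        exact ⟨⟨a.2, h1⟩, h2⟩
      · rintro ⟨⟨h, h1⟩, h2⟩
        exact ⟨⟨i, h⟩, x, ⟨h1, h2⟩, rfl⟩

theorem mem_levelVerts {k : ℕ} {t : PlaneTree} {x : Vertex} :
    x ∈ levelVerts k t ↔ x ∈ vertices t.outdegree ∧ x.length = k := by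
  induction k generalizing t x with
  | zero =>
    simp only [levelVerts, Finset.mem_singleton, List.length_eq_zero_iff]
    exact ⟨fun h => ⟨h ▸ mem_vertices_nil _, h⟩, fun h => h.2⟩
  | succ k ih =>
    obtain ⟨d, c⟩ := t
    cases x with
    | nil => simp [levelVerts, consEmb]
    | cons i x =>
      simp only [levelVerts, Finset.mem_biUnion,
        Finset.mem_univ, true_and, Finset.mem_map, ih, cons_mem_vertices_node, List.length_cons,
        Nat.add_right_cancel_iff]
      constructor
      · rintro ⟨a, y, ⟨h1, h2⟩, h3⟩
        obtain ⟨rfl, rfl⟩ := List.cons.inj h3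
        exact ⟨⟨a.2, h1⟩, h2⟩
      · rintro ⟨⟨h, h1⟩, h2⟩
        exact ⟨⟨i, h⟩, x, ⟨h1, h2⟩, rfl⟩

theorem pairwiseDisjoint_map_consEmb {d : ℕ} (V : Fin d → Finset Vertex) :
    ((Finset.univ : Finset (Fin d)) : Set (Fin d)).PairwiseDisjoint
      fun i => (V i).map (consEmb i) := by
  intro i _ j _ hij
  rw [Function.onFun, Finset.disjoint_left]
  intro x hx hx'
  obtain ⟨y, -, rfl⟩ := Finset.mem_map.1 hx
  obtain ⟨z, -, h⟩ := Finset.mem_map.1 hx'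
  exact hij (Fin.ext (List.cons.inj h).1.symm)

theorem card_levelVerts (k : ℕ) (t : PlaneTree) : (levelVerts k t).card = t.levelCard k := by
  induction k generalizing t with
  | zero => simp [levelVerts, levelCard]
  | succ k ih =>
    obtain ⟨d, c⟩ := t
    rw [levelVerts, Finset.card_biUnion (pairwiseDisjoint_map_consEmb _)]
    simp [ih, levelCard]

theorem truncMass_eq_prod (p : PMF ℕ) {k : ℕ} {t : PlaneTree} (h : t.truncMass p k ≠ 0) :
    t.truncMass p k = ∏ x ∈ lowVerts k t, p (t.outdegree x).toNat := by
  induction k generalizing t with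
  | zero =>
    obtain ⟨d, c⟩ := t
    simp only [truncMass] at h ⊢
    simp_all [lowVerts]
  | succ k ih =>
    obtain ⟨d, c⟩ := t
    have h1 := right_ne_zero_of_mul h
    rw [lowVerts, Finset.prod_insert (by simp [consEmb]),
      Finset.prod_biUnion (pairwiseDisjoint_map_consEmb _), truncMass]
    congr 1
    refine Finset.prod_congr rfl fun i _ => ?_
    rw [ih (Finset.prod_ne_zero_iff.1 h1 i (Finset.mem_univ i)), Finset.prod_map]
    refine Finset.prod_congr rfl fun x _ => ?_
    simp [consEmb, outdegree]

theorem eq_of_outdegree_eq (p : PMF ℕ) {k : ℕ} {t t' : PlaneTree} (ht : t.truncMass p k ≠ 0)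
    (ht' : t'.truncMass p k ≠ 0)
    (h : ∀ x : Vertex, x.length < k → t.outdegree x = t'.outdegree x) : t = t' := by
  induction k generalizing t t' with
  | zero =>
    obtain ⟨d, c⟩ := t
    obtain ⟨d', c'⟩ := t'
    simp only [truncMass, ne_eq, ite_eq_right_iff, one_ne_zero, imp_false, not_not] at ht ht'
    subst ht ht'
    congr 1
    exact Subsingleton.elim _ _
  | succ k ih =>
    obtain ⟨d, c⟩ := t
    obtain ⟨d', c'⟩ := t'
    have h0 := h [] (by simp)
    simp only [outdegree, Nat.cast_inj] at h0
    subst h0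
    congr 1
    funext i
    refine ih (Finset.prod_ne_zero_iff.1 (right_ne_zero_of_mul ht) i (Finset.mem_univ i))
      (Finset.prod_ne_zero_iff.1 (right_ne_zero_of_mul ht') i (Finset.mem_univ i)) fun x hx => ?_
    have := h (i :: x) (by simpa using hx)
    simpa [outdegree] using this

end PlaneTree

/-! ### The law of the modified Galton-Watson tree at bounded height -/

section ModifiedGW

theorem sizeBiased_natCast {w : ℕ → ℝ≥0} (hmean : ∑' k : ℕ, (k : ℝ≥0∞) * offspring w k = 1)
    (d : ℕ) : sizeBiased w d = d * offspring w d := by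
  classical
  have hsum : (∑' k : ℕ∞, if k = ⊤ then 1 - ∑' j : ℕ, (j : ℝ≥0∞) * offspring w j
      else (k : ℝ≥0∞) * offspring w k.toNat) = 1 := by
    rw [hmean, tsub_self]
    have h1 : Function.Injective ((↑) : ℕ → ℕ∞) := Nat.cast_injective
    rw [← h1.tsum_eq]
    · simpa using hmean
    · intro k hk
      induction k using ENat.recTopCoe with
      | top => simp at hk
      | coe k => exact ⟨k, rfl⟩
  rw [sizeBiased, ofWeights_apply (by rw [hsum]; simp) (by rw [hsum]; simp), hsum]
  simp

/-- A special vertex has `d` children and passes on to the `i`-th of them with probability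
`d π_d / d = π_d`. -/
theorem specialOffspring_apply {w : ℕ → ℝ≥0}
    (hmean : ∑' k : ℕ, (k : ℝ≥0∞) * offspring w k = 1) {d i : ℕ} (h : i < d) :
    specialOffspring w ((d : ℕ∞), i) = offspring w d := by
  classical
  have hsum : (∑' j : ℕ, if (j : ℕ∞) < (d : ℕ∞) then (1 : ℝ≥0∞) else 0) = d := by
    rw [tsum_eq_sum (s := Finset.range d)]
    · rw [Finset.sum_congr rfl fun j hj => if_pos (by simpa using hj)]
      simp
    · intro j hj
      simpa using hj
  have hd : (d : ℝ≥0∞) ≠ 0 := by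
    have : d ≠ 0 := by omega
    exact_mod_cast this
  rw [specialOffspring, PMF.bind_apply, tsum_eq_single (d : ℕ∞)]
  · rw [sizeBiased_natCast hmean, PMF.map_apply, tsum_eq_single i]
    · rw [if_pos rfl, ofWeights_apply (by rw [hsum]; exact hd) (by rw [hsum]; simp), hsum,
        if_pos (by exact_mod_cast h), mul_right_comm, one_div, ENNReal.mul_inv_cancel hd (by simp),
        one_mul]
    · intro j hj
      rw [if_neg]
      simpa using hj.symm
  · intro k hk
    rw [PMF.map_apply, ENNReal.tsum_eq_zero.2, mul_zero]
    intro j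
    rw [if_neg]
    simp [hk.symm]

open PlaneTree

/-- The values of the random input at the vertex `x` that are compatible with the tree `t` and with
the spine from the root to `v`. -/
def spineCond (t : PlaneTree) (v x : Vertex) : Set (ℕ × (ℕ∞ × ℕ)) :=
  open Classical in
  if x <+: v then {y | y.2 = (t.outdegree x, v.getD x.length 0)}
  else {y | (y.1 : ℕ∞) = t.outdegree x}

/-- The random inputs for which the modified Galton-Watson tree looks like `t` below height `k`, and
its spine passes through `v`. -/
def spineBox (k : ℕ) (t : PlaneTree) (v : Vertex) : Set (Vertex → ℕ × (ℕ∞ × ℕ)) :=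
  Set.pi (lowVerts k t) (spineCond t v)

theorem spineBox_of_prefix {k : ℕ} {t : PlaneTree} {v x : Vertex}
    {s : Vertex → ℕ × (ℕ∞ × ℕ)} (hs : s ∈ spineBox k t v) (hx : x ∈ lowVerts k t)
    (h : x <+: v) : (s x).2 = (t.outdegree x, v.getD x.length 0) := by
  have := hs x hx
  rwa [spineCond, if_pos h] at this

theorem spineBox_of_not_prefix {k : ℕ} {t : PlaneTree} {v x : Vertex}
    {s : Vertex → ℕ × (ℕ∞ × ℕ)} (hs : s ∈ spineBox k t v) (hx : x ∈ lowVerts k t)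
    (h : ¬ x <+: v) : ((s x).1 : ℕ∞) = t.outdegree x := by
  have := hs x hx
  rwa [spineCond, if_neg h] at this

theorem getD_length_of_append_prefix {u v : Vertex} {i : ℕ} (h : u ++ [i] <+: v) :
    v.getD u.length 0 = i := by
  obtain ⟨r, rfl⟩ := h
  simp

/-- A vertex on a path that is determined step by step is determined by its height. -/
theorem eq_of_forall_append_prefix (f : Vertex → ℕ) {x y : Vertex} (hl : x.length = y.length)
    (hx : ∀ (u : Vertex) (i : ℕ), u ++ [i] <+: x → i = f u)
    (hy : ∀ (u : Vertex) (i : ℕ), u ++ [i] <+: y → i = f u) : x = y := by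
  induction x using List.reverseRecOn generalizing y with
  | nil => exact (List.length_eq_zero_iff.1 hl.symm).symm
  | append_singleton x i ih =>
    rcases List.eq_nil_or_concat y with rfl | ⟨y, j, rfl⟩
    · simp at hl
    · rw [List.concat_eq_append] at hl hy ⊢
      have h1 : x = y := ih (by simpa using hl)
        (fun u i hu => hx u i (hu.trans (List.prefix_append _ _)))
        (fun u i hu => hy u i (hu.trans (List.prefix_append _ _)))
      subst h1
      rw [hx x i List.prefix_rfl, hy x j List.prefix_rfl]

theorem spine_step {k : ℕ} {t : PlaneTree} {v : Vertex} {s : Vertex → ℕ × (ℕ∞ × ℕ)}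
    (hs : s ∈ spineBox k t v) (hv : v ∈ levelVerts k t) (u : Vertex) (i : ℕ)
    (hu : u ++ [i] <+: v) : (s u).2.1 ≠ ⊤ ∧ i = (s u).2.2 := by
  have hvv := mem_levelVerts.1 hv
  have huv : u <+: v := (List.prefix_append _ _).trans hu
  have hlen := hu.length_le
  simp only [List.length_append, List.length_singleton] at hlen
  have h := spineBox_of_prefix hs
    (mem_lowVerts.2 ⟨mem_vertices_of_prefix huv hvv.1, by omega⟩) huv
  rw [h]
  exact ⟨outdegree_ne_top _ _, (getD_length_of_append_prefix hu).symm⟩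

theorem isSpecial_iff_of_mem_spineBox {k : ℕ} {t : PlaneTree} {v x : Vertex}
    {s : Vertex → ℕ × (ℕ∞ × ℕ)} (hs : s ∈ spineBox k t v) (hv : v ∈ levelVerts k t)
    (hx : x.length ≤ k) : IsSpecial s x ↔ x <+: v := by
  constructor
  · intro h
    have hlen : x.length = (v.take x.length).length := by
      rw [List.length_take, (mem_levelVerts.1 hv).2, min_eq_left hx]
    have : x = v.take x.length :=
      eq_of_forall_append_prefix (fun u => (s u).2.2) hlen (fun u i hu => (h u i hu).2)
        fun u i hu => (spine_step hs hv u i (hu.trans (List.take_prefix _ _))).2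
    rw [this]
    exact List.take_prefix _ _
  · intro h u i hu
    exact spine_step hs hv u i (hu.trans h)

theorem modifiedGW_eq_of_mem_spineBox {k : ℕ} {t : PlaneTree} {v : Vertex}
    {s : Vertex → ℕ × (ℕ∞ × ℕ)} (hs : s ∈ spineBox k t v) (hv : v ∈ levelVerts k t)
    {x : Vertex} (hx : x.length < k) : modifiedGW s x = t.outdegree x := by
  classical
  have h1 : ∀ y ∈ lowVerts k t, reproduction s y = t.outdegree y := by
    intro y hy
    have hyk := (mem_lowVerts.1 hy).2
    rw [reproduction]
    split_ifs with h
    · rw [spineBox_of_prefix hs hy ((isSpecial_iff_of_mem_spineBox hs hv hyk.le).1 h)]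
    · exact spineBox_of_not_prefix hs hy
        fun h' => h ((isSpecial_iff_of_mem_spineBox hs hv hyk.le).2 h')
  have h2 : ∀ y : Vertex, y.length ≤ k →
      (y ∈ vertices (reproduction s) ↔ y ∈ vertices t.outdegree) := by
    intro y
    induction y using List.reverseRecOn with
    | nil => exact fun _ => ⟨fun _ => mem_vertices_nil _, fun _ => mem_vertices_nil _⟩
    | append_singleton y i ih =>
      intro hy
      simp only [List.length_append, List.length_singleton] at hy
      rw [mem_vertices_append_singleton, mem_vertices_append_singleton, ih (by omega)]
      refine and_congr_right fun hyv => ?_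
      rw [h1 y (mem_lowVerts.2 ⟨hyv, by omega⟩)]
  rw [modifiedGW]
  split_ifs with h
  · exact h1 x (mem_lowVerts.2 ⟨(h2 x hx.le).1 h, hx⟩)
  · exact (outdegree_eq_zero fun h' => h ((h2 x hx.le).2 h')).symm

theorem measurableSet_spineBox (k : ℕ) (t : PlaneTree) (v : Vertex) :
    MeasurableSet (spineBox k t v) :=
  MeasurableSet.pi (Finset.countable_toSet _) fun _ _ => MeasurableSet.of_discrete

theorem branchingInput_spineBox {w : ℕ → ℝ≥0}
    (hmean : ∑' k : ℕ, (k : ℝ≥0∞) * offspring w k = 1) {k : ℕ} {t : PlaneTree} {v : Vertex}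
    (hv : v ∈ levelVerts k t) (ht : t.truncMass (offspring w) k ≠ 0) :
    branchingInput w (spineBox k t v) = t.truncMass (offspring w) k := by
  rw [branchingInput, spineBox, Measure.infinitePi_pi _ fun _ _ => MeasurableSet.of_discrete,
    truncMass_eq_prod _ ht]
  refine Finset.prod_congr rfl fun x hx => ?_
  obtain ⟨d, hd⟩ := ENat.ne_top_iff_exists.1 (outdegree_ne_top t x)
  rw [spineCond, ← hd, ENat.toNat_natCast]
  split_ifs with h
  · have h1 : {y : ℕ × (ℕ∞ × ℕ) | y.2 = ((d : ℕ∞), v.getD x.length 0)} =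
        Set.univ ×ˢ {((d : ℕ∞), v.getD x.length 0)} := by
      ext y; simp
    rw [h1, Measure.prod_prod, measure_univ, one_mul,
      PMF.toMeasure_apply_singleton _ _ (MeasurableSet.of_discrete), specialOffspring_apply hmean]
    obtain ⟨r, rfl⟩ := h
    have hv' := mem_levelVerts.1 hv
    have hx' := mem_lowVerts.1 hx
    cases r with
    | nil =>
      simp only [List.append_nil] at hv'
      omega
    | cons a r =>
      have h2 : x ++ [a] <+: x ++ a :: r := ⟨r, by simp⟩
      rw [getD_length_of_append_prefix h2]
      have := hv'.1 x a h2
      rw [← hd] at this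
      exact_mod_cast this
  · have h1 : {y : ℕ × (ℕ∞ × ℕ) | (y.1 : ℕ∞) = (d : ℕ∞)} = {d} ×ˢ Set.univ := by
      ext y; simp
    rw [h1, Measure.prod_prod, measure_univ, mul_one,
      PMF.toMeasure_apply_singleton _ _ (MeasurableSet.of_discrete)]

/-- The law of the modified Galton-Watson tree below height `k` is the law of the Galton-Watson tree
below height `k`, biased by the number of vertices of height `k`. -/
theorem lintegral_modifiedGW {w : ℕ → ℝ≥0}
    (hmean : ∑' k : ℕ, (k : ℝ≥0∞) * offspring w k = 1) (k : ℕ) {g : (Vertex → ℕ∞) → ℝ≥0∞}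
    (hg : ∀ D D' : Vertex → ℕ∞, (∀ x : Vertex, x.length < k → D x = D' x) → g D = g D') :
    ∫⁻ s, g (modifiedGW s) ∂branchingInput w =
      ∑' t : PlaneTree, t.truncMass (offspring w) k * t.levelCard k * g t.outdegree := by
  set p := offspring w with hp
  let ι := Σ t : {t : PlaneTree // t.truncMass p k ≠ 0}, levelVerts k t.1
  let B : ι → Set (Vertex → ℕ × (ℕ∞ × ℕ)) := fun j => spineBox k j.1.1 j.2.1
  have hBm : ∀ j, MeasurableSet (B j) := fun j => measurableSet_spineBox _ _ _
  have hBd : Pairwise (Function.onFun Disjoint B) := by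
    rintro ⟨⟨t, ht⟩, v, hv⟩ ⟨⟨t', ht'⟩, v', hv'⟩ hne
    rw [Function.onFun, Set.disjoint_left]
    intro s hs hs'
    simp only [B] at hs hs'
    obtain rfl : t = t' := eq_of_outdegree_eq p ht ht' fun x hx => by
      rw [← modifiedGW_eq_of_mem_spineBox hs hv hx, modifiedGW_eq_of_mem_spineBox hs' hv' hx]
    obtain rfl : v = v' := eq_of_forall_append_prefix (fun u => (s u).2.2)
      ((mem_levelVerts.1 hv).2.trans (mem_levelVerts.1 hv').2.symm)
      (fun u i hu => (spine_step hs hv u i hu).2) fun u i hu => (spine_step hs' hv' u i hu).2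
    exact hne rfl
  -- summation over the trees together with their spine vertices of height `k`
  have hsum : ∀ f : PlaneTree → ℝ≥0∞, ∑' j : ι, j.1.1.truncMass p k * f j.1.1 =
      ∑' t : PlaneTree, t.truncMass p k * t.levelCard k * f t := by
    intro f
    rw [ENNReal.tsum_sigma']
    have h1 : ∀ t : {t : PlaneTree // t.truncMass p k ≠ 0},
        ∑' _ : levelVerts k t.1, t.1.truncMass p k * f t.1 =
          t.1.truncMass p k * t.1.levelCard k * f t.1 := by
      intro t
      rw [tsum_fintype, Finset.sum_const, Finset.card_univ, Fintype.card_coe, card_levelVerts,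
        nsmul_eq_mul]
      ring
    rw [tsum_congr h1]
    exact tsum_subtype_eq_of_support_subset (s := {t : PlaneTree | t.truncMass p k ≠ 0})
      (f := fun t : PlaneTree => t.truncMass p k * t.levelCard k * f t) fun t ht h => ht (by
        simp [h])
  -- the boxes are disjoint, and their masses add up to the mean `1` of the size of generation `k`
  have hprob : IsProbabilityMeasure (branchingInput w) := by
    unfold branchingInput; infer_instance
  have hone : branchingInput w (⋃ j, B j) = 1 := by
    rw [measure_iUnion hBd hBm]
    have h1 : ∀ j : ι, branchingInput w (B j) = j.1.1.truncMass p k * 1 := fun j => by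
      rw [mul_one]; exact branchingInput_spineBox hmean j.2.2 j.1.2
    rw [tsum_congr h1, hsum fun _ => 1]
    simpa using tsum_truncMass_mul_levelCard hmean k
  have hae : ∀ᵐ s ∂branchingInput w, s ∈ ⋃ j, B j :=
    (prob_compl_eq_zero_iff (MeasurableSet.iUnion hBm)).2 hone
  rw [← Measure.restrict_eq_self_of_ae_mem hae, lintegral_iUnion hBm hBd, ← hsum]
  refine tsum_congr fun j => ?_
  rw [setLIntegral_congr_fun (g := fun _ => g j.1.1.outdegree) (hBm j), setLIntegral_const,
    branchingInput_spineBox hmean j.2.2 j.1.2, mul_comm]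
  intro s hs
  exact hg _ _ fun x hx => modifiedGW_eq_of_mem_spineBox hs j.2.2 hx

end ModifiedGW

/-! ### Comparison of the two random trees -/

section Comparison

open PowerSeries (coeff)
open PlaneTree

/-- Tilting does not change the relative weights of trees of the same size. -/
theorem mass_mul_pow {w : ℕ → ℝ≥0} (h0 : 0 < w 0) (h2 : ∃ m, 2 ≤ m ∧ 0 < w m) (hν : 1 ≤ nu w)
    (T : PlaneTree) :
    T.mass (offspring w) * phi w (tau w) ^ T.size * tau w = T.weight w * tau w ^ T.size := by
  have hφ := (tau_spec h0 h2 hν).2.1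
  induction T with
  | node d c ih =>
    have h1 : offspring w d * phi w (tau w) = w d * tau w ^ d := by
      rw [offspring_apply h0 h2 hν, ENNReal.div_mul_cancel (phi_ne_zero h0 _) hφ]
    simp only [mass, size, weight, pow_add, pow_one, ENNReal.coe_mul, ENNReal.ofNNReal_finsetProd,
      ← Finset.prod_pow_eq_pow_sum]
    calc _ = (offspring w d * phi w (tau w)) *
          (∏ i, (c i).mass (offspring w) * phi w (tau w) ^ (c i).size) * tau w := by
          rw [Finset.prod_mul_distrib]; ring
      _ = w d * (∏ i, (c i).mass (offspring w) * phi w (tau w) ^ (c i).size * tau w) * tau w := by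
          rw [h1, Finset.prod_mul_distrib (f := fun i => (c i).mass (offspring w) *
            phi w (tau w) ^ (c i).size)]
          simp only [Finset.prod_const, Finset.card_univ, Fintype.card_fin]
          ring
      _ = _ := by
          rw [Finset.prod_congr rfl fun i _ => ih i, Finset.prod_mul_distrib]
          ring

theorem simplyGenerated_apply {w : ℕ → ℝ≥0} (h0 : 0 < w 0) (h2 : ∃ m, 2 ≤ m ∧ 0 < w m)
    (hν : 1 ≤ nu w) {n : ℕ} (hn : coeff n (treeSeries (offspring w)) ≠ 0)
    (hn' : coeff n (treeSeries (offspring w)) ≠ ∞) (T : PlaneTree) :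
    simplyGenerated w n T = (if T.size = n then T.mass (offspring w) else 0) /
      coeff n (treeSeries (offspring w)) := by
  classical
  have hτ := (tau_spec h0 h2 hν).1
  have hτ0 := tau_ne_zero h0 h2 hν
  set K := phi w (tau w) ^ n * tau w / tau w ^ n with hK
  have hτn : tau w ^ n ≠ 0 := pow_ne_zero _ hτ0
  have hτn' : tau w ^ n ≠ ∞ := ENNReal.pow_ne_top hτ
  have hK0 : K ≠ 0 :=
    ENNReal.div_ne_zero.2 ⟨mul_ne_zero (pow_ne_zero _ (phi_ne_zero h0 _)) hτ0, hτn'⟩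
  have hK' : K ≠ ∞ := ENNReal.div_ne_top
    (ENNReal.mul_ne_top (ENNReal.pow_ne_top (tau_spec h0 h2 hν).2.1) hτ) hτn
  have hf : ∀ T : PlaneTree, (if T.size = n then (T.weight w : ℝ≥0∞) else 0) =
      K * if T.size = n then T.mass (offspring w) else 0 := by
    intro T
    split_ifs with h
    · have := mass_mul_pow h0 h2 hν T
      rw [h] at this
      rw [hK, ENNReal.mul_comm_div, ← mul_div_assoc, ENNReal.eq_div_iff hτn hτn', mul_comm, ← this]
      ring
    · rw [mul_zero]
  have hsum : (∑' T : PlaneTree, if T.size = n then (T.weight w : ℝ≥0∞) else 0) =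
      K * coeff n (treeSeries (offspring w)) := by
    simp_rw [hf, ENNReal.tsum_mul_left]
    rw [treeSeries, PowerSeries.coeff_mk]
  rw [simplyGenerated, ofWeights_apply (by rw [hsum]; exact mul_ne_zero hK0 hn)
    (by rw [hsum]; exact ENNReal.mul_ne_top hK' hn'), hsum, hf,
    ENNReal.mul_div_mul_left _ _ hK0 hK']

theorem PlaneTree.exists_lowCard_add_levelCard (p : PMF ℕ) {d : ℕ} (hd : ∀ k, p k ≠ 0 → d ∣ k)
    {k : ℕ} {t : PlaneTree} (ht : t.truncMass p k ≠ 0) :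
    ∃ e, t.lowCard k + t.levelCard k = 1 + d * e := by
  induction k generalizing t with
  | zero => exact ⟨0, by simp [lowCard, levelCard]⟩
  | succ k ih =>
    obtain ⟨r, c⟩ := t
    obtain ⟨a, rfl⟩ := hd r (left_ne_zero_of_mul ht)
    choose e he using fun i =>
      ih (Finset.prod_ne_zero_iff.1 (right_ne_zero_of_mul ht) i (Finset.mem_univ i))
    refine ⟨a + ∑ i, e i, ?_⟩
    simp only [lowCard, levelCard]
    rw [add_assoc, ← Finset.sum_add_distrib, Finset.sum_congr rfl fun i _ => he i,
      Finset.sum_add_distrib, ← Finset.mul_sum, mul_add]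
    simp

/-- The local limit theorem as a comparison of the masses of two endpoints of the random walk. -/
theorem exists_mul_stepMass_le (p : PMF ℕ) (hmean : ∑' k : ℕ, (k : ℝ≥0∞) * p k = 1)
    (hsq : ∑' k : ℕ, (k : ℝ≥0∞) ^ 2 * p k ≠ ∞) (h0 : p 0 ≠ 0) (d : ℕ)
    (hd : d = Nat.setGcd {k | p k ≠ 0}) (hd0 : 0 < d) {η : ℝ} (hη0 : 0 < η) (hη : η < 1) :
    ∃ δ > 0, δ ≤ 1 ∧ ∃ M : ℕ, 0 < M ∧ ∀ m n l : ℕ, M ≤ m → m ≤ n → l ≤ m → d ∣ n - 1 →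
      d ∣ m - l → (l : ℝ) ≤ δ * √m →
      0 < stepMass p n (n - 1) ∧ η * stepMass p n (n - 1) ≤ stepMass p m (m - l) := by
  obtain ⟨C, hC, hLLT⟩ := exists_tendsto_sqrt_mul_stepMass p hmean hsq h0 d hd hd0
  -- with this error term `e` one has `η * (C + e) ≤ C - e`
  obtain ⟨δ, hδ, M, hM⟩ := hLLT (C * (1 - η) / 2) (by nlinarith)
  obtain ⟨M', hM'⟩ := exists_nat_gt ((1 / δ) ^ 2)
  -- `n ≥ M'` makes the deviation `-1` of the endpoint `n - 1` admissible
  refine ⟨min δ 1, by positivity, min_le_right _ _, max (max M M') 1, by simp, ?_⟩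
  intro m n l hm hmn hlm hdn hdm hl
  have hMm : M ≤ m := by omega
  have hm1 : 1 ≤ m := by omega
  have hsm : 0 < √(m : ℝ) := Real.sqrt_pos.2 (by exact_mod_cast hm1)
  have hsmn : √(m : ℝ) ≤ √(n : ℝ) := Real.sqrt_le_sqrt (by exact_mod_cast hmn)
  have h1 := hM m hMm (m - l) hdm (by
    rw [Nat.cast_sub hlm, show (m : ℝ) - l - m = -l by ring, abs_neg, abs_of_nonneg (by positivity)]
    exact hl.trans (by gcongr; exact min_le_left _ _))
  have h2 := hM n (hMm.trans hmn) (n - 1) hdn (by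
    rw [Nat.cast_sub (by omega), show (n : ℝ) - (1 : ℕ) - n = -1 by push_cast; ring, abs_neg,
      abs_one]
    have h3 : 1 / δ ≤ √(n : ℝ) := by
      refine Real.le_sqrt_of_sq_le (hM'.le.trans ?_)
      have : M' ≤ n := by omega
      exact_mod_cast this
    rw [div_le_iff₀ hδ] at h3
    linarith)
  rw [abs_le] at h1 h2
  set a : ℝ := NNReal.toReal (stepMass p n (n - 1))
  set b : ℝ := NNReal.toReal (stepMass p m (m - l))
  have hb : 0 ≤ b := NNReal.coe_nonneg _
  have ha : 0 ≤ a := NNReal.coe_nonneg _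
  have hCη : 0 < C * (1 - η) := by nlinarith
  constructor
  · have h3 : 0 < √(n : ℝ) * a := by nlinarith
    have : (0 : ℝ) < a := by
      by_contra hcon
      have : a = 0 := le_antisymm (not_lt.1 hcon) ha
      rw [this, mul_zero] at h3
      exact lt_irrefl _ h3
    exact NNReal.coe_pos.1 this
  · have h3 : √(m : ℝ) * (η * a) ≤ √(m : ℝ) * b := by
      calc √(m : ℝ) * (η * a) ≤ √(n : ℝ) * (η * a) := by gcongr
        _ = η * (√(n : ℝ) * a) := by ring
        _ ≤ η * (C + C * (1 - η) / 2) := by gcongr; linarith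
        _ ≤ C - C * (1 - η) / 2 := by nlinarith
        _ ≤ _ := by linarith
    exact le_of_mul_le_mul_left h3 hsm

theorem lintegral_simplyGeneratedLaw (w : ℕ → ℝ≥0) (n k : ℕ) {g : (Vertex → ℕ∞) → ℝ≥0∞}
    (hgm : Measurable g)
    (hg : ∀ D D' : Vertex → ℕ∞, (∀ x : Vertex, x.length < k → D x = D' x) → g D = g D') :
    ∫⁻ D, g D ∂simplyGeneratedLaw w n = ∑' t : PlaneTree, (∑' T : PlaneTree,
      open Classical in if T.truncate k = t then simplyGenerated w n T else 0) *
        g t.outdegree := by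
  classical
  rw [simplyGeneratedLaw, lintegral_map hgm measurable_outdegree, lintegral_countable']
  simp_rw [← ENNReal.tsum_mul_right]
  rw [ENNReal.tsum_comm]
  refine tsum_congr fun T => ?_
  rw [tsum_eq_single (T.truncate k) fun t ht => by rw [if_neg ht.symm, zero_mul], if_pos rfl,
    PMF.toMeasure_apply_singleton _ _ (MeasurableSet.of_discrete), mul_comm]
  congr 1
  exact (hg _ _ fun x hx => outdegree_truncate hx).symm

/-- A truncated tree with few vertices is nearly as likely for the simply generated tree as for the
modified Galton-Watson tree. -/
theorem exists_truncMass_le {w : ℕ → ℝ≥0} (h0 : 0 < w 0) (h2 : ∃ m, 2 ≤ m ∧ 0 < w m)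
    (hI : TypeIAlpha w) {η : ℝ} (hη0 : 0 < η) (hη : η < 1) :
    ∃ δ > 0, ∃ M : ℕ, ∀ n ≥ M, n ≡ 1 [MOD span w] → ∀ (k : ℕ) (t : PlaneTree),
      (t.levelCard k : ℝ) ≤ δ * √(n / 2) → (t.lowCard k : ℝ) ≤ n / 2 →
      ENNReal.ofReal η * (t.truncMass (offspring w) k * t.levelCard k) ≤
        ∑' T : PlaneTree, open Classical in
          if T.truncate k = t then simplyGenerated w n T else 0 := by
  classical
  have hν := hI.1
  set p := offspring w with hp
  have hmean : ∑' k : ℕ, (k : ℝ≥0∞) * p k = 1 := tsum_mul_offspring h0 h2 hν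
  have hp0 : p 0 ≠ 0 := (offspring_ne_zero_iff h0 h2 hν 0).2 h0
  have hspan := span_eq_setGcd_offspring h0 h2 hν
  obtain ⟨δ, hδ, hδ1, M, hM0, hM⟩ := exists_mul_stepMass_le p hmean
    (tsum_sq_mul_offspring_ne_top hI) hp0 (span w) hspan (span_pos h2) hη0 hη
  refine ⟨δ, hδ, 2 * M, fun n hn hmod k t hL hN => ?_⟩
  by_cases ht : t.truncMass p k = 0
  · simp [ht]
  have hn1 : 1 ≤ n := by omega
  have hdvd : ∀ k, p k ≠ 0 → span w ∣ k := fun k hk => by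
    rw [hspan]; exact Nat.setGcd_dvd_of_mem hk
  have hNn : 2 * t.lowCard k ≤ n := by
    have : (2 : ℝ) * t.lowCard k ≤ n := by linarith
    exact_mod_cast this
  obtain ⟨m, hm⟩ := Nat.exists_eq_add_of_le (show t.lowCard k ≤ n by omega)
  have hMm : M ≤ m := by omega
  have hmn : m ≤ n := by omega
  have hm2 : (n : ℝ) / 2 ≤ m := by
    have : n ≤ 2 * m := by omega
    have : (n : ℝ) ≤ 2 * m := by exact_mod_cast this
    linarith
  have hL' : (t.levelCard k : ℝ) ≤ δ * √m := hL.trans (by gcongr)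
  have hLm : t.levelCard k ≤ m := by
    have h3 : √(m : ℝ) ≤ m := by
      rw [Real.sqrt_le_left (by positivity)]
      have : (1 : ℝ) ≤ m := by exact_mod_cast (by omega : 1 ≤ m)
      nlinarith
    have : (t.levelCard k : ℝ) ≤ m := by
      calc (t.levelCard k : ℝ) ≤ δ * √m := hL'
        _ ≤ 1 * √m := by gcongr
        _ ≤ m := by rw [one_mul]; exact h3
    exact_mod_cast this
  have hd1 : span w ∣ n - 1 := (Nat.modEq_iff_dvd' hn1).1 hmod.symm
  have hd2 : span w ∣ m - t.levelCard k := by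
    obtain ⟨e, he⟩ := PlaneTree.exists_lowCard_add_levelCard p hdvd ht
    obtain ⟨f, hf⟩ := hd1
    refine (Nat.dvd_add_right (Dvd.intro e rfl : span w ∣ span w * e)).1 ⟨f, ?_⟩
    omega
  obtain ⟨hpos, hle⟩ := hM m n (t.levelCard k) hMm hmn hLm hd1 hd2 hL'
  set L := t.levelCard k
  have hZn : (n : ℝ≥0∞) * coeff n (treeSeries p) = stepMass p n (n - 1) := by
    have := mul_coeff_treeSeries_pow p 1 (n - 1)
    rwa [Nat.add_sub_cancel' hn1, pow_one, Nat.cast_one, one_mul] at this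
  have hZm : (m : ℝ≥0∞) * coeff m (treeSeries p ^ L) = L * stepMass p m (m - L) := by
    have := mul_coeff_treeSeries_pow p L (m - L)
    rwa [Nat.add_sub_cancel' hLm] at this
  have hn0 : (n : ℝ≥0∞) ≠ 0 := by exact_mod_cast (by omega : n ≠ 0)
  have hm0 : (m : ℝ≥0∞) ≠ 0 := by exact_mod_cast (by omega : m ≠ 0)
  have hZ0 : coeff n (treeSeries p) ≠ 0 := by
    intro h
    rw [h, mul_zero] at hZn
    exact hpos.ne (by exact_mod_cast hZn)
  have hZtop : coeff n (treeSeries p) ≠ ∞ := by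
    intro h
    rw [h, ENNReal.mul_top hn0] at hZn
    exact ENNReal.coe_ne_top hZn.symm
  have hsum : (∑' T : PlaneTree, if T.truncate k = t then simplyGenerated w n T else 0) =
      t.truncMass p k * coeff m (treeSeries p ^ L) / coeff n (treeSeries p) := by
    rw [← tsum_truncate_eq p k t m, ← hm, div_eq_mul_inv, ← ENNReal.tsum_mul_right]
    refine tsum_congr fun T => ?_
    rw [simplyGenerated_apply h0 h2 hν hZ0 hZtop, div_eq_mul_inv]
    by_cases h3 : T.truncate k = t <;> by_cases h4 : T.size = n <;> simp [h3, h4, hp]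
  rw [hsum, ENNReal.le_div_iff_mul_le (Or.inl hZ0) (Or.inl hZtop)]
  have hle' : ENNReal.ofReal η * stepMass p n (n - 1) ≤ stepMass p m (m - L) := by
    rw [← ENNReal.ofReal_coe_nnreal, ← ENNReal.ofReal_coe_nnreal, ← ENNReal.ofReal_mul hη0.le]
    exact ENNReal.ofReal_le_ofReal hle
  have key : ENNReal.ofReal η * L * coeff n (treeSeries p) ≤ coeff m (treeSeries p ^ L) := by
    refine (ENNReal.mul_le_mul_iff_right (mul_ne_zero hn0 hm0)
      (ENNReal.mul_ne_top (ENNReal.natCast_ne_top n) (ENNReal.natCast_ne_top m))).1 ?_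
    calc (n * m : ℝ≥0∞) * (ENNReal.ofReal η * L * coeff n (treeSeries p))
        = m * L * (ENNReal.ofReal η * (n * coeff n (treeSeries p))) := by ring
      _ ≤ n * L * stepMass p m (m - L) := by rw [hZn]; gcongr
      _ = n * (m * coeff m (treeSeries p ^ L)) := by rw [hZm]; ring
      _ = _ := by ring
  calc ENNReal.ofReal η * (t.truncMass p k * L) * coeff n (treeSeries p)
      = t.truncMass p k * (ENNReal.ofReal η * L * coeff n (treeSeries p)) := by ring
    _ ≤ _ := by gcongr

/-- One-sided comparison of the laws of the two trees below a height of smaller order than `√n`,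
uniformly in the test function. -/
theorem eventually_lintegral_modifiedGWLaw_le {w : ℕ → ℝ≥0} (h0 : 0 < w 0)
    (h2 : ∃ m, 2 ≤ m ∧ 0 < w m) (hI : TypeIAlpha w) (k : ℕ → ℕ)
    (hk : (fun n => (k n : ℝ)) =o[atTop] fun n : ℕ => √(n : ℝ)) {ε : ℝ} (hε : 0 < ε) :
    ∀ᶠ n in atTop ⊓ 𝓟 {n : ℕ | n ≡ 1 [MOD span w]}, ∀ g : (Vertex → ℕ∞) → ℝ≥0∞,
      Measurable g → (∀ D, g D ≤ 1) →
      (∀ D D' : Vertex → ℕ∞, (∀ x : Vertex, x.length < k n → D x = D' x) → g D = g D') →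
      ∫⁻ D, g D ∂modifiedGWLaw w ≤ ∫⁻ D, g D ∂simplyGeneratedLaw w n + ENNReal.ofReal ε := by
  set p := offspring w with hp
  have hmean : ∑' k : ℕ, (k : ℝ≥0∞) * p k = 1 := tsum_mul_offspring h0 h2 hI.1
  have hV : factMoment p ≠ ∞ := factMoment_ne_top p (tsum_sq_mul_offspring_ne_top hI)
  set V := (factMoment p).toReal with hVdef
  have hV0 : 0 ≤ V := ENNReal.toReal_nonneg
  obtain ⟨η, hη0, hη, hηε⟩ : ∃ η : ℝ, 0 < η ∧ η < 1 ∧ 1 - η ≤ ε / 2 :=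
    ⟨max (1 / 2) (1 - ε / 2), by positivity, by simp; constructor <;> linarith,
      by linarith [le_max_right (1 / 2) (1 - ε / 2)]⟩
  obtain ⟨δ, hδ, M, hM⟩ := exists_truncMass_le h0 h2 hI hη0 hη
  -- Markov bounds for the number of vertices at height `k n` and below it
  have hlim : Tendsto (fun n : ℕ => (1 + k n * V) / (δ * √(n / 2)) +
      (k n + k n * k n * V) / ((n : ℝ) / 2)) atTop (𝓝 0) := by
    have hsqrt : Tendsto (fun n : ℕ => √(n : ℝ)) atTop atTop :=
      Real.tendsto_sqrt_atTop.comp tendsto_natCast_atTop_atTop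
    have hr : Tendsto (fun n : ℕ => (k n : ℝ) / √(n : ℝ)) atTop (𝓝 0) := hk.tendsto_div_nhds_zero
    have hi : Tendsto (fun n : ℕ => (√(n : ℝ))⁻¹) atTop (𝓝 0) := hsqrt.inv_tendsto_atTop
    have h3 : Tendsto (fun n : ℕ => ((√(n : ℝ))⁻¹ + (k n : ℝ) / √(n : ℝ) * V) * (√2 / δ) +
        ((k n : ℝ) / √(n : ℝ) * (√(n : ℝ))⁻¹ +
          (k n : ℝ) / √(n : ℝ) * ((k n : ℝ) / √(n : ℝ)) * V) * 2)
        atTop (𝓝 ((0 + 0 * V) * (√2 / δ) + (0 * 0 + 0 * 0 * V) * 2)) :=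
      ((hi.add (hr.mul_const V)).mul_const _).add
        (((hr.mul hi).add ((hr.mul hr).mul_const V)).mul_const 2)
    simp only [zero_mul, add_zero] at h3
    refine h3.congr' ?_
    filter_upwards [eventually_gt_atTop 0] with n hn
    have hn' : (0 : ℝ) < n := by exact_mod_cast hn
    have hs : 0 < √(n : ℝ) := Real.sqrt_pos.2 hn'
    have hs2 : √(n : ℝ) * √(n : ℝ) = n := Real.mul_self_sqrt hn'.le
    have e1 : √((n : ℝ) / 2) = √(n : ℝ) / √2 := Real.sqrt_div hn'.le 2
    have e2 : ((k n : ℝ) + k n * k n * V) / ((n : ℝ) / 2) =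
        (k n + k n * k n * V) / (√(n : ℝ) * √(n : ℝ) / 2) := by rw [hs2]
    rw [e1, e2]
    field_simp
  have hev : ∀ᶠ n : ℕ in atTop, (1 + k n * V) / (δ * √(n / 2)) +
      (k n + k n * k n * V) / ((n : ℝ) / 2) < ε / 2 := hlim.eventually_lt_const (by linarith)
  rw [eventually_inf_principal]
  filter_upwards [hev, eventually_ge_atTop M, eventually_gt_atTop 0] with n hn hnM hn0 hmod g hgm
    hg1 hg
  have hn' : (0 : ℝ) < n := by exact_mod_cast hn0
  set a := δ * √((n : ℝ) / 2) with ha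
  set b := (n : ℝ) / 2 with hb
  have ha0 : 0 < a := by positivity
  have hb0 : 0 < b := by positivity
  rw [modifiedGWLaw, lintegral_map hgm measurable_modifiedGW, lintegral_modifiedGW hmean (k n) hg,
    lintegral_simplyGeneratedLaw w n (k n) hgm hg]
  set P : PlaneTree → ℝ≥0∞ := fun t => ∑' T : PlaneTree, open Classical in
    if T.truncate (k n) = t then simplyGenerated w n T else 0 with hP
  -- the last two summands are Markov's bounds for trees with more than `a` vertices of height `k n`
  -- or more than `b` vertices below it
  have hterm : ∀ t : PlaneTree, t.truncMass p (k n) * t.levelCard (k n) * g t.outdegree ≤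
      P t * g t.outdegree + ENNReal.ofReal (1 - η) * (t.truncMass p (k n) * t.levelCard (k n)) +
      (t.truncMass p (k n) * ((t.levelCard (k n) : ℝ≥0∞) * t.levelCard (k n)) / ENNReal.ofReal a +
       t.truncMass p (k n) * ((t.levelCard (k n) : ℝ≥0∞) * t.lowCard (k n)) /
        ENNReal.ofReal b) := by
    intro t
    set q := t.truncMass p (k n)
    set L := t.levelCard (k n)
    set N := t.lowCard (k n)
    by_cases hL : (L : ℝ) ≤ a
    · by_cases hN : (N : ℝ) ≤ b
      · refine le_trans ?_ le_self_add
        have h3 := hM n hnM hmod (k n) t hL hN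
        calc q * L * g t.outdegree
            = (ENNReal.ofReal η + ENNReal.ofReal (1 - η)) * (q * L * g t.outdegree) := by
              rw [← ENNReal.ofReal_add hη0.le (by linarith)]
              simp
          _ = ENNReal.ofReal η * (q * L) * g t.outdegree +
              ENNReal.ofReal (1 - η) * (q * L * g t.outdegree) := by ring
          _ ≤ P t * g t.outdegree + ENNReal.ofReal (1 - η) * (q * L) := by
              exact add_le_add (mul_le_mul_left h3 _)
                (mul_le_mul_right (mul_le_of_le_one_right (by simp) (hg1 _)) _)
      · have h3 : (1 : ℝ≥0∞) ≤ N / ENNReal.ofReal b := by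
          rw [ENNReal.le_div_iff_mul_le (Or.inl (by simpa using hb0)) (Or.inl (by simp)), one_mul,
            ← ENNReal.ofReal_natCast]
          exact ENNReal.ofReal_le_ofReal (not_le.1 hN).le
        refine le_trans ?_ (le_add_self.trans le_add_self)
        calc q * L * g t.outdegree ≤ q * L * (N / ENNReal.ofReal b) := by
              gcongr; exact (hg1 _).trans h3
          _ = _ := by rw [← mul_div_assoc, mul_assoc]
    · have h3 : (1 : ℝ≥0∞) ≤ L / ENNReal.ofReal a := by
        rw [ENNReal.le_div_iff_mul_le (Or.inl (by simpa using ha0)) (Or.inl (by simp)), one_mul,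
          ← ENNReal.ofReal_natCast]
        exact ENNReal.ofReal_le_ofReal (not_le.1 hL).le
      refine le_trans ?_ (le_self_add.trans le_add_self)
      calc q * L * g t.outdegree ≤ q * L * (L / ENNReal.ofReal a) := by
            gcongr; exact (hg1 _).trans h3
        _ = _ := by rw [← mul_div_assoc, mul_assoc]
  refine (ENNReal.tsum_le_tsum hterm).trans ?_
  rw [ENNReal.tsum_add, ENNReal.tsum_add, add_assoc]
  refine add_le_add le_rfl ?_
  rw [ENNReal.tsum_add, ENNReal.tsum_mul_left, tsum_truncMass_mul_levelCard hmean, mul_one]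
  simp_rw [div_eq_mul_inv]
  rw [ENNReal.tsum_mul_right, ENNReal.tsum_mul_right, tsum_truncMass_mul_levelCard_sq hmean,
    ← div_eq_mul_inv, ← div_eq_mul_inv]
  have hVe : factMoment p = ENNReal.ofReal V := (ENNReal.ofReal_toReal hV).symm
  have e1 : (1 + k n * factMoment p) / ENNReal.ofReal a = ENNReal.ofReal ((1 + k n * V) / a) := by
    rw [hVe, ENNReal.ofReal_div_of_pos ha0, ENNReal.ofReal_add (by simp) (by positivity),
      ENNReal.ofReal_mul (by positivity)]
    simp
  have e2 : (k n + k n * k n * factMoment p) / ENNReal.ofReal b =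
      ENNReal.ofReal ((k n + k n * k n * V) / b) := by
    rw [hVe, ENNReal.ofReal_div_of_pos hb0, ENNReal.ofReal_add (by positivity) (by positivity),
      ENNReal.ofReal_mul (by positivity), ENNReal.ofReal_mul (by positivity)]
    simp
  calc _ ≤ ENNReal.ofReal (1 - η) + ((1 + k n * factMoment p) / ENNReal.ofReal a +
        (k n + k n * k n * factMoment p) / ENNReal.ofReal b) := by
        gcongr
        exact tsum_truncMass_mul_levelCard_mul_lowCard_le hmean (k n)
    _ = ENNReal.ofReal (1 - η + ((1 + k n * V) / a + (k n + k n * k n * V) / b)) := by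
        rw [e1, e2, ← ENNReal.ofReal_add (by positivity) (by positivity),
          ← ENNReal.ofReal_add (by linarith) (by positivity)]
    _ ≤ ENNReal.ofReal ε := ENNReal.ofReal_le_ofReal (by linarith)

end Comparison

/-! ### Enriched trees -/

section Enriched

variable {R : Species.{v}} (κ : Weighting R)

theorem mem_vertices_congr {k : ℕ} {D D' : Vertex → ℕ∞}
    (h : ∀ x : Vertex, x.length < k → D x = D' x) {x : Vertex} (hx : x.length ≤ k) :
    x ∈ vertices D ↔ x ∈ vertices D' := by
  refine forall_congr' fun u => forall_congr' fun i => forall_congr' fun hu => ?_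
  have := hu.length_le
  simp only [List.length_append, List.length_singleton] at this
  rw [h u (by omega)]

theorem trim_decorate_congr {k : ℕ} {D D' : Vertex → ℕ∞}
    (h : ∀ x : Vertex, x.length < k + 1 → D x = D' x) (B : Vertex × ℕ → Mark R) :
    trim k (decorate (D, B)) = trim k (decorate (D', B)) := by
  have h1 : ∀ x : Vertex, x.length ≤ k → decorate (D, B) x = decorate (D', B) x := by
    intro x hx
    have hv := mem_vertices_congr h (by omega : x.length ≤ k + 1)
    by_cases hxD : x ∈ vertices D
    · simp [decorate, hxD, hv.1 hxD, h x (by omega)]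
    · simp [decorate, hxD, mt hv.2 hxD]
  rw [trim, trim, Prod.mk.injEq]
  constructor
  · ext x
    exact and_congr_left fun hx => by rw [h1 x hx]
  · funext x
    split_ifs with hx
    · exact h1 x hx.le
    · rfl

instance : IsProbabilityMeasure κ.structureField := by
  unfold Weighting.structureField; infer_instance

instance (P : Measure (Vertex → ℕ∞)) [IsProbabilityMeasure P] :
    IsProbabilityMeasure (κ.enrich P) := by
  unfold Weighting.enrich
  exact Measure.isProbabilityMeasure_map measurable_decorate.aemeasurable

instance (w : ℕ → ℝ≥0) (n : ℕ) : IsProbabilityMeasure (simplyGeneratedLaw w n) := by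
  unfold simplyGeneratedLaw
  exact Measure.isProbabilityMeasure_map measurable_outdegree.aemeasurable

instance (w : ℕ → ℝ≥0) : IsProbabilityMeasure (modifiedGWLaw w) := by
  unfold modifiedGWLaw branchingInput
  exact Measure.isProbabilityMeasure_map measurable_modifiedGW.aemeasurable

theorem enrich_map_trim_apply (P : Measure (Vertex → ℕ∞)) [IsProbabilityMeasure P] (k : ℕ)
    {A : Set (Set Vertex × (Vertex → Mark R))} (hA : MeasurableSet A) :
    (κ.enrich P).map (trim k) A =
      ∫⁻ D, κ.structureField (Prod.mk D ⁻¹' (decorate ⁻¹' (trim k ⁻¹' A))) ∂P := by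
  rw [Measure.map_apply (measurable_trim k) hA, Weighting.enrich,
    Measure.map_apply measurable_decorate (measurable_trim k hA),
    Measure.prod_apply (measurable_decorate (measurable_trim k hA))]

/-- A one-sided bound on all events bounds the total variation distance. -/
theorem tvDist_le {α : Type*} [MeasurableSpace α] (P Q : Measure α) [IsProbabilityMeasure P]
    [IsProbabilityMeasure Q] {ε : ℝ} (hε : 0 ≤ ε)
    (h : ∀ A, MeasurableSet A → Q A ≤ P A + ENNReal.ofReal ε) : tvDist P Q ≤ ε := by
  have hreal : ∀ A, MeasurableSet A → Q.real A ≤ P.real A + ε := by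
    intro A hA
    have h1 := ENNReal.toReal_mono
      (ENNReal.add_ne_top.2 ⟨measure_ne_top P A, ENNReal.ofReal_ne_top⟩) (h A hA)
    rwa [ENNReal.toReal_add (measure_ne_top P A) ENNReal.ofReal_ne_top,
      ENNReal.toReal_ofReal hε] at h1
  have : Nonempty {A : Set α // MeasurableSet A} := ⟨⟨∅, MeasurableSet.empty⟩⟩
  refine ciSup_le fun A => ?_
  have h1 := hreal A.1 A.2
  have h2 := hreal A.1ᶜ A.2.compl
  rw [measureReal_compl A.2, measureReal_compl A.2, probReal_univ, probReal_univ] at h2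
  exact abs_le.2 ⟨by linarith, by linarith⟩

theorem tvDist_nonneg {α : Type*} [MeasurableSpace α] (P Q : Measure α) : 0 ≤ tvDist P Q :=
  Real.iSup_nonneg fun _ => abs_nonneg _

end Enriched

end EnrichedTrees

end

theorem mainTheorem2 (R : EnrichedTrees.Species.{v}) (κ : EnrichedTrees.Weighting R)
    (h0 : 0 < κ.weightSeq 0) (h2 : ∃ m, 2 ≤ m ∧ 0 < κ.weightSeq m)
    (hI : EnrichedTrees.TypeIAlpha κ.weightSeq)
    (k : ℕ → ℕ) (hk : ∀ n, 0 < k n)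
    (hko : (fun n => (k n : ℝ)) =o[atTop] fun n : ℕ => Real.sqrt n) :
    Tendsto
      (fun n => EnrichedTrees.tvDist
        (κ.finiteTreeLaw n |>.map (EnrichedTrees.trim (k n)))
        (κ.limitTreeLaw |>.map (EnrichedTrees.trim (k n))))
      (atTop ⊓ 𝓟 {n : ℕ | n ≡ 1 [MOD EnrichedTrees.span κ.weightSeq]}) (𝓝 0) := by
  rw [Metric.tendsto_nhds]
  intro ε hε
  -- structures at height `k n` enter the trimming through its vertex set, so the outdegrees are
  -- compared up to and including that height
  have hk1 : (fun n => ((k n + 1 : ℕ) : ℝ)) =o[atTop] fun n : ℕ => √(n : ℝ) := by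
    push_cast
    refine hko.add ?_
    refine (Asymptotics.isLittleO_const_left.2 (Or.inr ?_))
    exact tendsto_norm_atTop_atTop.comp
      (Real.tendsto_sqrt_atTop.comp tendsto_natCast_atTop_atTop)
  filter_upwards [EnrichedTrees.eventually_lintegral_modifiedGWLaw_le h0 h2 hI (fun n => k n + 1)
    hk1 (half_pos hε)] with n hn
  rw [Real.dist_eq, sub_zero, abs_of_nonneg (EnrichedTrees.tvDist_nonneg _ _)]
  have hP : IsProbabilityMeasure
      ((κ.enrich (EnrichedTrees.simplyGeneratedLaw κ.weightSeq n)).map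
        (EnrichedTrees.trim (k n))) :=
    Measure.isProbabilityMeasure_map (EnrichedTrees.measurable_trim _).aemeasurable
  have hQ : IsProbabilityMeasure
      ((κ.enrich (EnrichedTrees.modifiedGWLaw κ.weightSeq)).map (EnrichedTrees.trim (k n))) :=
    Measure.isProbabilityMeasure_map (EnrichedTrees.measurable_trim _).aemeasurable
  refine lt_of_le_of_lt (EnrichedTrees.tvDist_le
    ((κ.enrich (EnrichedTrees.simplyGeneratedLaw κ.weightSeq n)).map (EnrichedTrees.trim (k n)))
    ((κ.enrich (EnrichedTrees.modifiedGWLaw κ.weightSeq)).map (EnrichedTrees.trim (k n)))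
    (half_pos hε).le fun A hA => ?_) (half_lt_self hε)
  rw [EnrichedTrees.enrich_map_trim_apply κ _ _ hA, EnrichedTrees.enrich_map_trim_apply κ _ _ hA]
  refine hn _ ?_ (fun D => prob_le_one) fun D D' hD => ?_
  · exact measurable_measure_prodMk_left
      (EnrichedTrees.measurable_decorate (EnrichedTrees.measurable_trim _ hA))
  · congr 1
    ext B
    simp only [Set.mem_preimage]
    rw [EnrichedTrees.trim_decorate_congr hD B]
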